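/- For a polynomial $f=\sum_i f_i x^i$ over a commutative ring $R$ and $T\ge 0$ let $P_T(f)\in R^{T\times T}$ be the lower-triangular Toeplitz matrix with entry $f_{a-b}$ at $(a,b)$ for $b\le a$ and $0$ elsewhere ($0\le a,b<T$). Indices are counted from $0$. **Theorem.** Iterated multiplication of $n\times n$ matrices over $R[x]$ with entries of degree $\mathrm{poly}(n)$ is logspace reducible to iterated multiplication of $\mathrm{poly}(n)\times\mathrm{poly}(n)$ matrices over $R$, for every commutative ring $R$. In detail, there are functions $T(n,d)$ and $\psi(n,d,i,j,k)\in\mathbb N^2$ and two deterministic logspace transducers $F$ and $G$, all independent of $R$, such that the following holds. 1. The size is polynomial: for every polynomial $p$ there is a polynomial $q$ with $n\,T(n,d)\le q(n)$ for all $n$ and all $d\le p(n)$. 2. $\psi$ is logspace computable: on input $(n,d,i,j,k)$, written in unary, with $i,j<n$ and $k\le nd$, the machine $G$ outputs $\psi(n,d,i,j,k)$ in unary, in space logarithmic in the input length. 3. For every commutative ring $R$, $P_T(fg)=P_T(f)P_T(g)$ for all $T$ and all $f,g\in R[x]$. Moreover, let $n,d\ge 0$, let $A_1,\dots,A_n$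 be $n\times n$ matrices over $R[x]$ whose entries have degree at most $d$, and let $\mathbf A=A_1A_2\cdots A_n$. Let $B_l$ be the $nT\times nT$ matrix over $R$, $T=T(n,d)$, that is obtained from $A_l$ by replacing every entry $f$ by the block $P_T(f)$, and let $\mathbf B=B_1B_2\cdots B_n$. Then - $F$ computes $(B_1,\dots,B_n)$ from $(A_1,\dots,A_n)$ in space logarithmic in the input length, for every encoding of the elements of $R$ by words over some (finite or infinite) alphabet, where a polynomial is given by its $d+1$ coefficients of $x^0,\dots,x^d$. Here $F$ does not inspect the symbols in which ring elements are written: it can only copy them from the input to the output, and write the code of $0\in R$. - for all $i,j<n$ and $k\le nd$ the pair $\psi(n,d,i,j,k)$ is a valid index of $\mathbf B$, and the coefficient of $x^k$ in $\mathbf A_{ij}$ equals $\mathbf B_{\psi(n,d,i,j,k)}$. (Since the entries of $\mathbf A$ have degree at most $nd$, all their other coefficients vanish.) -/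

import Mathlib

/-! Deterministic logarithmic-space transducers, the encodings of the instances of iterated matrix
multiplication over `R[X]` and over `R`, and lower-triangular Toeplitz matrices. -/

namespace LogspaceIMM

open Polynomial

/-- A head movement. -/
inductive Move
  | left
  | stay
  | right

/-- What the finite control sees on the input tape. The tape alphabet is `P ⊕ D`: a finite set `P`
of delimiters and a set `D` of data symbols, in which ring elements are written. The control
recognises each delimiter, and recognises that a cell holds a data symbol, but does not see which
one; `D` may thus be infinite (`D = R`, every ring element being one symbol), while for finite `D`
one has a (restricted) ordinary Turing machine. -/
inductive Scan (P : Type)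
  | leftEnd
  | rightEnd
  | delim (p : P)
  | datum

/-- What a step appends to the output: nothing, a delimiter, the data symbol under the input head,
or the code of the ring element `0`. -/
inductive Emit (P : Type)
  | nothing
  | delim (p : P)
  | copy
  | zero

/-- What the machine does in one step; `State` are the states, `Γ` is the work alphabet, and `k` the
number of work tapes. -/
structure Action (P State Γ : Type) (k : ℕ) where
  next : State
  inputMove : Move
  write : Fin k → Γ
  workMove : Fin k → Move
  emit : Emit P

/-- A deterministic off-line Turing machine with a two-way read-only input tape, `k` two-way
infinite read-write work tapes, and a write-only output tape. The machine halts where the transition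
function has the value `none`. -/
structure Transducer (P : Type) where
  State : Type
  finite_state : Finite State
  start : State
  Γ : Type
  finite_work : Finite Γ
  blank : Γ
  k : ℕ
  δ : State → Scan P → (Fin k → Γ) → Option (Action P State Γ k)

namespace Transducer

variable {P : Type}

/-- A configuration. Cell `0` of the input tape holds the left endmarker, the cells `1, …, |w|` hold
the input word `w`, and cell `|w| + 1` holds the right endmarker. -/
structure Cfg (M : Transducer P) (D : Type*) where
  state : M.State
  inputPos : ℕ
  workPos : Fin M.k → ℤ
  work : Fin M.k → ℤ → M.Γ
  output : List (P ⊕ D)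

/-- The start configuration. -/
def init (M : Transducer P) (D : Type*) : M.Cfg D where
  state := M.start
  inputPos := 0
  workPos := fun _ => 0
  work := fun _ _ => M.blank
  output := []

/-- The content of an input cell, as the control sees it. -/
def scan {D : Type*} (w : List (P ⊕ D)) : ℕ → Scan P
  | 0 => .leftEnd
  | i + 1 =>
    match w[i]? with
    | none => .rightEnd
    | some (.inl p) => .delim p
    | some (.inr _) => .datum

/-- The new position of the input head, which never leaves the cells `0, …, |w| + 1`. -/
def moveInput (len : ℕ) : Move → ℕ → ℕ
  | .left, p => p - 1
  | .stay, p => p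
  | .right, p => min (p + 1) (len + 1)

/-- The new position of a work head. -/
def moveWork : Move → ℤ → ℤ
  | .left, p => p - 1
  | .stay, p => p
  | .right, p => p + 1

/-- The symbols that one step appends to the output, where `z` is the code of the ring element `0`
and `p` is the position of the input head; `copy` emits nothing if the head is not on a data
symbol. -/
def emitted {D : Type*} (z : List D) (w : List (P ⊕ D)) (p : ℕ) : Emit P → List (P ⊕ D)
  | .nothing => []
  | .delim a => [.inl a]
  | .zero => z.map .inr
  | .copy =>
    match p with
    | 0 => []
    | i + 1 =>
      match w[i]? with
      | some (.inr x) => [.inr x]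
      | _ => []

/-- One step of the machine on the input `w`; `none` if the machine has halted. -/
def step (M : Transducer P) {D : Type*} (z : List D) (w : List (P ⊕ D)) (s : M.Cfg D) :
    Option (M.Cfg D) :=
  (M.δ s.state (scan w s.inputPos) (fun t => s.work t (s.workPos t))).map fun a =>
    { state := a.next
      inputPos := moveInput w.length a.inputMove s.inputPos
      workPos := fun t => moveWork (a.workMove t) (s.workPos t)
      work := fun t => Function.update (s.work t) (s.workPos t) (a.write t)
      output := s.output ++ emitted z w s.inputPos a.emit }

/-- The configuration `s` is reachable on the input `w`. -/
def Reachable (M : Transducer P) {D : Type*} (z : List D) (w : List (P ⊕ D)) (s : M.Cfg D) : Prop :=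
  Relation.ReflTransGen (fun a b => M.step z w a = some b) (M.init D) s

/-- On the input `w` the machine halts with the output `o`, and no work head ever leaves the cells
`-b, …, b` of its tape. -/
def ComputesInSpace (M : Transducer P) {D : Type*} (z : List D) (w o : List (P ⊕ D)) (b : ℕ) :
    Prop :=
  (∃ s, M.Reachable z w s ∧ M.step z w s = none ∧ s.output = o) ∧
    ∀ s, M.Reachable z w s → ∀ t, |s.workPos t| ≤ (b : ℤ)

/-- On the input `w` the machine computes `o` in space `c * (log |w| + 1)`. A machine that does so,
with one constant `c`, for all `w` of a set of inputs is a logspace machine on these inputs. -/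
def ComputesInLogspace (M : Transducer P) (c : ℕ) {D : Type*} (z : List D) (w o : List (P ⊕ D)) :
    Prop :=
  M.ComputesInSpace z w o (c * (Nat.log 2 w.length + 1))

end Transducer

/-- The marks that end a coefficient, a matrix entry, a row and a matrix. -/
inductive Delim
  | coeffEnd
  | entryEnd
  | rowEnd
  | matrixEnd

/-- A tuple of matrices as a word: matrix by matrix, row by row, entry by entry, where `f` is the
word for an entry; every entry, row and matrix is followed by its mark. -/
def encodeMatrices {S D : Type*} {n m : ℕ} (f : S → List (Delim ⊕ D))
    (A : Fin n → Matrix (Fin m) (Fin m) S) : List (Delim ⊕ D) :=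
  (List.finRange n).flatMap fun l =>
    ((List.finRange m).flatMap fun i =>
      ((List.finRange m).flatMap fun j => f (A l i j) ++ [.inl .entryEnd]) ++ [.inl .rowEnd])
    ++ [.inl .matrixEnd]

/-- The word for a ring element, where `enc` is the chosen encoding of the elements of the ring by
words of data symbols. -/
def encodeElem {R D : Type*} (enc : R → List D) (a : R) : List (Delim ⊕ D) :=
  (enc a).map .inr

/-- The word for a polynomial of degree at most `d`: its coefficients of `x^0, …, x^d`, each
followed by its mark. -/
def encodePoly {R D : Type*} [CommRing R] (enc : R → List D) (d : ℕ) (f : R[X]) :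
    List (Delim ⊕ D) :=
  (List.range (d + 1)).flatMap fun k => encodeElem enc (f.coeff k) ++ [.inl .coeffEnd]

/-- A tuple of natural numbers in unary; `true` is the digit, `false` ends a number. There are no
data symbols. -/
def encodeNats (L : List ℕ) : List (Bool ⊕ Empty) :=
  L.flatMap fun a => List.replicate a (.inl true) ++ [.inl false]

/-- The lower-triangular `T × T` Toeplitz matrix `P(f)` of a polynomial, with entry `f_{a-b}` at
`(a, b)` for `b ≤ a`. -/
def toeplitz {R : Type*} [CommRing R] (T : ℕ) (f : R[X]) : Matrix (Fin T) (Fin T) R :=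
  Matrix.of fun a b => if b ≤ a then f.coeff ((a : ℕ) - (b : ℕ)) else 0

/-- The `nT × nT` matrix that is obtained from an `n × n` matrix of polynomials by replacing every
entry `f` by the block `P(f)`; row `a` of block row `i` is row `i * T + a`. -/
def blockToeplitz {R : Type*} [CommRing R] {n : ℕ} (T : ℕ) (A : Matrix (Fin n) (Fin n) R[X]) :
    Matrix (Fin (n * T)) (Fin (n * T)) R :=
  Matrix.of fun r s =>
    toeplitz T (A (finProdFinEquiv.symm r).1 (finProdFinEquiv.symm s).1)
      (finProdFinEquiv.symm r).2 (finProdFinEquiv.symm s).2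

end LogspaceIMM

/-!
Truncation modulo `x^T` makes `P_T` a ring homomorphism from `R[X]` to the lower-triangular
Toeplitz matrices (`toeplitz_mul`, `toeplitz_one`, `toeplitz_sum`), and so replacing every entry
`f` of an `n × n` matrix by its block `P_T(f)` is multiplicative (`blockToeplitz_mul`). The block
at `(i, j)` of `B₁ ⋯ Bₙ` is therefore `P_T` of the entry `(i, j)` of `A₁ ⋯ Aₙ`, whose first column
lists the coefficients of `x^0, …, x^(T-1)`. With `T = n * (d + 1)` this covers all degrees up to
`n * d`, and the coefficient of `x^k` is the entry `(i * T + k, j * T)`. This choice of `T` is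
also convenient for the machine: it is the number of coefficients in the first row of the input.

The machines are assembled from `Routine`s by sequential composition, branching and loops. Their
work tapes hold counters in bijective base 2, which are incremented and decremented by `count`.
The relation `Exec` describes a run of a routine by its effect on the input head, the counters and
the output; it includes the space bound. A counter whose value is at most the input length `|w|`
fits into `log |w| + 1` cells, so every routine whose counters are bounded by `|w|` runs in
logarithmic space; as machines are deterministic, it is enough to bound the space along the one
run that is exhibited (`Exec.computesInLogspace`).

`putToeplitz` counts `T`, and then runs over the matrices, rows and entries of the input by moving
its input head; for every row it repeats `T` times to emit the row `a` of all blocks of that row.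
Row `a` of `P_T(f)` is `f_a, …, f_0, 0, …, 0`, and `f_i` is found by skipping `i` coefficients
from the first cell of the entry, where a coefficient that is not there counts as zero. For its
correctness the input is viewed as a nested list of codes of ring elements (`exec_putToeplitz`,
`nestedCodes`). `putIndices` computes `(i * T + k, j * T)` in unary by nested loops
(`exec_putIndices`).
-/

namespace LogspaceIMM

/-! ### Routines -/

/-- A machine part with `k` work tapes whose work alphabet consists of a blank and two digits.
It exits when it is in a situation for which it has no transition. -/
structure Routine (P : Type) (k : ℕ) where
  State : Type
  finite_state : Finite State
  start : State
  δ : State → Scan P → (Fin k → Option Bool) → Option (Action P State (Option Bool) k)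

/-- The same action, with the next state renamed. -/
def Action.mapState {P S S' Γ : Type} {k : ℕ} (f : S → S') (a : Action P S Γ k) :
    Action P S' Γ k where
  next := f a.next
  inputMove := a.inputMove
  write := a.write
  workMove := a.workMove
  emit := a.emit

/-- The action that only changes the state to `q`; `g` are the symbols under the work heads. -/
def Action.goto {P S Γ : Type} {k : ℕ} (q : S) (g : Fin k → Γ) : Action P S Γ k where
  next := q
  inputMove := .stay
  write := g
  workMove := fun _ => .stay
  emit := .nothing

namespace Routine

variable {P : Type} {k : ℕ}

/-- A routine as a machine of its own. -/
abbrev toTransducer (M : Routine P k) : Transducer P where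
  State := M.State
  finite_state := M.finite_state
  start := M.start
  Γ := Option Bool
  finite_work := inferInstance
  blank := none
  k := k
  δ := M.δ

/-- A test that the control can perform in one step: it depends on the scanned input cell and on
which counters are nonzero. -/
abbrev Test (P : Type) (k : ℕ) := Scan P → (Fin k → Bool) → Bool

/-- Sequential composition: the exits of `M` lead to the start of `N`. -/
def seq (M N : Routine P k) : Routine P k where
  State := M.State ⊕ N.State
  finite_state := by have := M.finite_state; have := N.finite_state; infer_instance
  start := .inl M.start
  δ
    | .inl q, sc, g => some <| match M.δ q sc g with
      | some a => a.mapState .inl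
      | none => .goto (.inr N.start) g
    | .inr q, sc, g => (N.δ q sc g).map (Action.mapState .inr)

/-- `M` if the test succeeds, and `N` otherwise. -/
def cond (test : Test P k) (M N : Routine P k) : Routine P k where
  State := Option (M.State ⊕ N.State)
  finite_state := by have := M.finite_state; have := N.finite_state; infer_instance
  start := none
  δ
    | none, sc, g => some <| .goto (some <|
        if test sc fun t => (g t).isSome then .inl M.start else .inr N.start) g
    | some (.inl q), sc, g => (M.δ q sc g).map (Action.mapState fun q => some (.inl q))
    | some (.inr q), sc, g => (N.δ q sc g).map (Action.mapState fun q => some (.inr q))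

/-- Repeat `M` as long as the test succeeds. -/
def loop (test : Test P k) (M : Routine P k) : Routine P k where
  State := Option M.State
  finite_state := by have := M.finite_state; infer_instance
  start := none
  δ
    | none, sc, g => if test sc fun t => (g t).isSome then some (.goto (some M.start) g) else none
    | some q, sc, g => some <| match M.δ q sc g with
      | some a => a.mapState some
      | none => .goto none g

/-- The routine that exits at once. -/
def skip : Routine P k where
  State := Unit
  finite_state := inferInstance
  start := ()
  δ _ _ _ := none

/-- A single step: emit `e` and move the input head. -/
def act (m : Move) (e : Emit P) : Routine P k where
  State := Bool
  finite_state := inferInstance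
  start := false
  δ
    | false, _, g => some
        { next := true, inputMove := m, write := g, workMove := fun _ => .stay, emit := e }
    | true, _, _ => none

/-! ### Counters on work tapes -/

/-- The successor in bijective base 2, least significant digit first; `false` stands for the digit 1
and `true` for the digit 2. -/
def succDigits : List Bool → List Bool
  | [] => [false]
  | false :: l => true :: l
  | true :: l => false :: succDigits l

/-- The predecessor in bijective base 2. -/
def predDigits : List Bool → List Bool
  | [] => []
  | true :: l => false :: l
  | [false] => []
  | false :: x :: l => true :: predDigits (x :: l)

/-- The value of a word in bijective base 2. -/
def value : List Bool → ℕ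
  | [] => 0
  | false :: l => 2 * value l + 1
  | true :: l => 2 * value l + 2

/-- The representation of a number in bijective base 2. Unlike binary, it is unique, and `0` is the
empty word, so that one glance at the first cell tells whether a counter is zero. -/
def digits (v : ℕ) : List Bool := succDigits^[v] []

theorem digits_succ (v : ℕ) : digits (v + 1) = succDigits (digits v) :=
  Function.iterate_succ_apply' ..

theorem succDigits_ne_nil (l : List Bool) : succDigits l ≠ [] := by
  rcases l with _ | ⟨_ | _, l⟩ <;> simp [succDigits]

theorem predDigits_succDigits (l : List Bool) : predDigits (succDigits l) = l := by
  induction l with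
  | nil => rfl
  | cons x l ih =>
    cases x
    · rfl
    · simp only [succDigits]
      rcases h : succDigits l with _ | ⟨y, m⟩
      · exact absurd h (succDigits_ne_nil l)
      · rw [predDigits, ← h, ih]

theorem value_succDigits (l : List Bool) : value (succDigits l) = value l + 1 := by
  induction l with
  | nil => rfl
  | cons x l ih => cases x <;> simp [succDigits, value, ih]; ring

theorem value_digits (v : ℕ) : value (digits v) = v := by
  induction v with
  | zero => rfl
  | succ v ih => rw [digits_succ, value_succDigits, ih]

theorem two_pow_length_le (l : List Bool) : 2 ^ l.length ≤ value l + 1 := by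
  induction l with
  | nil => simp [value]
  | cons x l ih => cases x <;> simp [value, pow_succ] <;> omega

theorem length_digits_le {v m : ℕ} (h : v ≤ m) : (digits v).length ≤ Nat.log 2 m + 1 := by
  have h1 := two_pow_length_le (digits v)
  rw [value_digits] at h1
  have h2 : m < 2 ^ (Nat.log 2 m + 1) := Nat.lt_pow_succ_log_self (by norm_num) m
  exact (Nat.pow_le_pow_iff_right (by norm_num : 1 < 2)).1 (by omega)

theorem isSome_head_digits (v : ℕ) : (digits v)[0]?.isSome = decide (0 < v) := by
  cases v with
  | zero => rfl
  | succ v =>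
    rw [digits_succ]
    have := succDigits_ne_nil (digits v)
    rcases h : succDigits (digits v) with _ | _ <;> simp_all

/-- The tape with the word `l` in the cells `0, 1, …`. -/
def tape (l : List Bool) (i : ℤ) : Option Bool := if 0 ≤ i then l[i.toNat]? else none

/-! ### Executions -/

variable {D : Type*}

/-- The configuration with the input head at `p`, the numbers `c t` on the work tapes, and all work
heads on their cells `0`. -/
def conf (D : Type*) (M : Routine P k) (q : M.State) (p : ℕ) (c : Fin k → ℕ) (o : List (P ⊕ D)) :
    M.toTransducer.Cfg D where
  state := q
  inputPos := p
  workPos := fun _ => 0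
  work := fun t => tape (digits (c t))
  output := o

/-- No work head is further than `log |w| + 1` from its origin. -/
def Within (w : List (P ⊕ D)) {M : Routine P k} (s : M.toTransducer.Cfg D) : Prop :=
  ∀ t, |s.workPos t| ≤ (Nat.log 2 w.length + 1 : ℕ)

/-- The machine gets from `s` to `s'` within the space bound. -/
def Leads (z : List D) (w : List (P ⊕ D)) {M : Routine P k} (s s' : M.toTransducer.Cfg D) : Prop :=
  Relation.ReflTransGen (fun a b => M.toTransducer.step z w a = some b ∧ Within w a) s s'

/-- Started with the input head at `p` and counters `c`, the routine `M` exits with the input head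
at `p'` and counters `c'`, having emitted `o`, and never leaves the space bound. -/
def Exec (z : List D) (w : List (P ⊕ D)) (M : Routine P k) (p : ℕ) (c : Fin k → ℕ)
    (o : List (P ⊕ D)) (p' : ℕ) (c' : Fin k → ℕ) : Prop :=
  ∀ o₀, ∃ q, Leads z w (conf D M M.start p c o₀) (conf D M q p' c' (o₀ ++ o)) ∧
    M.toTransducer.step z w (conf D M q p' c' (o₀ ++ o)) = none

theorem within_conf (w : List (P ⊕ D)) (M : Routine P k) (q p c o) :
    Within w (conf D M q p c o) := by
  intro t
  simp only [conf, abs_zero]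
  positivity

/-- The configuration with the state renamed. -/
def lift {M N : Routine P k} (f : M.State → N.State) (s : M.toTransducer.Cfg D) :
    N.toTransducer.Cfg D where
  state := f s.state
  inputPos := s.inputPos
  workPos := s.workPos
  work := s.work
  output := s.output

variable {z : List D} {w : List (P ⊕ D)}

theorem Leads.lift {M N : Routine P k} {f : M.State → N.State}
    (hf : ∀ q sc g a, M.δ q sc g = some a → N.δ (f q) sc g = some (a.mapState f))
    {s s' : M.toTransducer.Cfg D} (h : Leads z w s s') :
    Leads z w (lift f s) (lift f s') := by
  refine Relation.ReflTransGen.lift (Routine.lift f) ?_ _ _ h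
  rintro a b ⟨hs, hw⟩
  refine ⟨?_, hw⟩
  unfold Transducer.step at hs ⊢
  rw [Option.map_eq_some_iff] at hs
  obtain ⟨x, hx, rfl⟩ := hs
  rw [Option.map_eq_some_iff]
  exact ⟨_, hf _ _ _ _ hx, rfl⟩

theorem Leads.lift_conf {M N : Routine P k} {f : M.State → N.State}
    {q q' : M.State} {p p' c c'} {o o' : List (P ⊕ D)}
    (h : Leads z w (conf D M q p c o) (conf D M q' p' c' o'))
    (hf : ∀ q sc g a, M.δ q sc g = some a → N.δ (f q) sc g = some (a.mapState f)) :
    Leads z w (conf D N (f q) p c o) (conf D N (f q') p' c' o') :=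
  h.lift hf

theorem step_conf_of_goto {M : Routine P k} {q q' : M.State} {p c} {o : List (P ⊕ D)}
    (h : ∀ g, (∀ t, g t = (digits (c t))[0]?) →
      M.δ q (Transducer.scan w p) g = some (.goto q' g)) :
    M.toTransducer.step z w (conf D M q p c o) = some (conf D M q' p c o) := by
  unfold Transducer.step
  rw [Option.map_eq_some_iff]
  refine ⟨_, h _ fun t => by simp [conf, tape], ?_⟩
  simp [conf, Action.goto, Transducer.moveInput, Transducer.moveWork, Transducer.emitted]

theorem step_conf_eq_none {M : Routine P k} {q : M.State} {p c} {o : List (P ⊕ D)} :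
    M.toTransducer.step z w (conf D M q p c o) = none ↔
      M.δ q (Transducer.scan w p) (fun t => (digits (c t))[0]?) = none := by
  unfold Transducer.step
  simp [conf, tape]

theorem Leads.tail_conf {M : Routine P k} {s : M.toTransducer.Cfg D} {q p c o s'}
    (h : Leads z w s (conf D M q p c o))
    (h' : M.toTransducer.step z w (conf D M q p c o) = some s') : Leads z w s s' :=
  Relation.ReflTransGen.tail h ⟨h', within_conf w M q p c o⟩

theorem Leads.head_conf {M : Routine P k} {q p c o} {s s' : M.toTransducer.Cfg D}
    (h' : M.toTransducer.step z w (conf D M q p c o) = some s)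
    (h : Leads z w s s') : Leads z w (conf D M q p c o) s' :=
  Relation.ReflTransGen.head ⟨h', within_conf w M q p c o⟩ h

theorem Leads.trans {M : Routine P k} {s s' s'' : M.toTransducer.Cfg D}
    (h : Leads z w s s') (h' : Leads z w s' s'') : Leads z w s s'' :=
  Relation.ReflTransGen.trans h h'

variable {M N : Routine P k} {test : Test P k} {p p' p'' : ℕ} {c c' c'' : Fin k → ℕ}
  {o o' : List (P ⊕ D)}

theorem Exec.seq (h : Exec z w M p c o p' c') (h' : Exec z w N p' c' o' p'' c'') :
    Exec z w (M.seq N) p c (o ++ o') p'' c'' := by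
  intro o₀
  obtain ⟨q, hq, hn⟩ := h o₀
  obtain ⟨q', hq', hn'⟩ := h' (o₀ ++ o)
  have hn := step_conf_eq_none.1 hn
  have hn' := step_conf_eq_none.1 hn'
  rw [← List.append_assoc]
  refine ⟨Sum.inr q', ?_, step_conf_eq_none.2 (by simp [Routine.seq, hn'])⟩
  have h1 := hq.lift_conf (N := M.seq N) (f := Sum.inl) fun q sc g a ha => by
    simp [Routine.seq, ha]
  have h2 := hq'.lift_conf (N := M.seq N) (f := Sum.inr) fun q sc g a ha => by
    simp [Routine.seq, ha]
  refine (h1.tail_conf (step_conf_of_goto fun g hg => ?_)).trans h2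
  obtain rfl : g = _ := funext hg
  simp [Routine.seq, hn]

theorem Exec.seq_silent (h : Exec z w M p c [] p' c') (h' : Exec z w N p' c' o p'' c'') :
    Exec z w (M.seq N) p c o p'' c'' :=
  h.seq h'

theorem Exec.cond_pos (ht : test (Transducer.scan w p) (fun t => decide (0 < c t)) = true)
    (h : Exec z w M p c o p' c') : Exec z w (cond test M N) p c o p' c' := by
  intro o₀
  obtain ⟨q, hq, hn⟩ := h o₀
  have hn := step_conf_eq_none.1 hn
  refine ⟨some (Sum.inl q), ?_, step_conf_eq_none.2 (by simp [cond, hn])⟩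
  have h1 := hq.lift_conf (N := cond test M N) (f := fun q => some (Sum.inl q))
    fun q sc g a ha => by simp [cond, ha]
  refine Leads.head_conf (step_conf_of_goto fun g hg => ?_) h1
  simp [cond, hg, isSome_head_digits, ht]

theorem Exec.cond_neg (ht : test (Transducer.scan w p) (fun t => decide (0 < c t)) = false)
    (h : Exec z w N p c o p' c') : Exec z w (cond test M N) p c o p' c' := by
  intro o₀
  obtain ⟨q, hq, hn⟩ := h o₀
  have hn := step_conf_eq_none.1 hn
  refine ⟨some (Sum.inr q), ?_, step_conf_eq_none.2 (by simp [cond, hn])⟩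
  have h1 := hq.lift_conf (N := cond test M N) (f := fun q => some (Sum.inr q))
    fun q sc g a ha => by simp [cond, ha]
  refine Leads.head_conf (step_conf_of_goto fun g hg => ?_) h1
  simp [cond, hg, isSome_head_digits, ht]

theorem Exec.loop_neg (ht : test (Transducer.scan w p) (fun t => decide (0 < c t)) = false) :
    Exec z w (loop test M) p c [] p c := by
  intro o₀
  rw [List.append_nil]
  refine ⟨none, .refl, step_conf_eq_none.2 ?_⟩
  simp [loop, isSome_head_digits, ht]

theorem Exec.loop_pos (ht : test (Transducer.scan w p) (fun t => decide (0 < c t)) = true)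
    (h : Exec z w M p c o p' c') (h' : Exec z w (loop test M) p' c' o' p'' c'') :
    Exec z w (loop test M) p c (o ++ o') p'' c'' := by
  intro o₀
  obtain ⟨q, hq, hn⟩ := h o₀
  obtain ⟨q', hq', hn'⟩ := h' (o₀ ++ o)
  have hn := step_conf_eq_none.1 hn
  rw [← List.append_assoc]
  refine ⟨q', ?_, hn'⟩
  have h1 := hq.lift_conf (N := loop test M) (f := some) fun q sc g a ha => by simp [loop, ha]
  refine (Leads.head_conf (step_conf_of_goto fun g hg => ?_) h1).trans
    (Leads.head_conf (step_conf_of_goto fun g hg => ?_) hq')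
  · simp [loop, hg, isSome_head_digits, ht]
  · obtain rfl : g = _ := funext hg
    simp [loop, hn]

theorem Exec.loop_pos_silent
    (ht : test (Transducer.scan w p) (fun t => decide (0 < c t)) = true)
    (h : Exec z w M p c [] p' c') (h' : Exec z w (loop test M) p' c' o p'' c'') :
    Exec z w (loop test M) p c o p'' c'' :=
  Exec.loop_pos ht h h'

theorem exec_skip : Exec z w skip p c [] p c := by
  intro o₀
  rw [List.append_nil]
  exact ⟨(), .refl, rfl⟩

theorem exec_act (m : Move) (e : Emit P) :
    Exec z w (act m e) p c (Transducer.emitted z w p e) (Transducer.moveInput w.length m p) c := by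
  intro o₀
  refine ⟨true, Leads.head_conf (s := conf D (act m e) true _ _ _) ?_ .refl, rfl⟩
  simp [Transducer.step, conf, act, Transducer.moveWork]

/-- The machine is deterministic, so an execution from the start configuration visits every
reachable configuration. -/
theorem Exec.computesInLogspace (h : Exec z w M 0 (fun _ => 0) o p' c') :
    M.toTransducer.ComputesInLogspace 1 z w o := by
  obtain ⟨q, hq, hn⟩ := h []
  have h0 : M.toTransducer.init D = conf D M M.start 0 (fun _ => 0) [] := by
    simp only [Transducer.init, conf]
    congr
    funext t i
    simp [tape, digits]
  simp only [Transducer.ComputesInLogspace, Transducer.ComputesInSpace, Transducer.Reachable, h0]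
  refine ⟨⟨_, Relation.ReflTransGen.mono (fun _ _ h => h.1) _ _ hq, hn, rfl⟩, ?_⟩
  rw [one_mul]
  generalize conf D M M.start 0 (fun _ => 0) [] = s₀ at hq
  induction hq using Relation.ReflTransGen.head_induction_on with
  | refl =>
    intro s hs
    rcases Relation.ReflTransGen.cases_head hs with rfl | ⟨a, ha, -⟩
    · exact within_conf w M q p' c' _
    · rw [hn] at ha; cases ha
  | head h _ ih =>
    intro s hs
    rcases Relation.ReflTransGen.cases_head hs with rfl | ⟨a, ha, hs⟩
    · exact h.2
    · rw [h.1] at ha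
      cases ha
      exact ih s hs

end Routine

/-! ### Incrementing and decrementing a counter -/

namespace Routine

variable {P : Type} {k : ℕ} {D : Type*}

/-- The phases of a counter update: travelling along the carry or borrow, erasing a vanishing
leading digit, returning to the first cell, and exit. -/
inductive Phase
  | carry
  | erase
  | back
  | done

instance : Finite Phase :=
  .of_surjective (fun i : Fin 4 => match i with
    | 0 => Phase.carry
    | 1 => Phase.erase
    | 2 => Phase.back
    | 3 => Phase.done) fun q => by
    cases q
    exacts [⟨0, rfl⟩, ⟨1, rfl⟩, ⟨2, rfl⟩, ⟨3, rfl⟩]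

/-- Write `y` on tape `t`, move its head by `m`, and leave everything else as it is. -/
def onTape {Γ : Type} (t : Fin k) (q : Phase) (y : Γ) (m : Move) (g : Fin k → Γ) :
    Action P Phase Γ k where
  next := q
  inputMove := .stay
  write := Function.update g t y
  workMove := Function.update (fun _ => .stay) t m
  emit := .nothing

/-- Add 1 to counter `t` (if `up`) or subtract 1 from it, provided it is nonzero. -/
def count (up : Bool) (t : Fin k) : Routine P k where
  State := Phase
  finite_state := inferInstance
  start := .carry
  δ
    | .carry, _, g => some <| match up, g t with
      | true, none => onTape t .back (some false) .left g
      | true, some false => onTape t .back (some true) .left g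
      | true, some true => onTape t .carry (some false) .right g
      | false, none => onTape t .erase none .left g
      | false, some false => onTape t .carry (some true) .right g
      | false, some true => onTape t .back (some false) .left g
    | .erase, _, g => some (onTape t .back none .left g)
    | .back, _, g => some <| match g t with
      | none => onTape t .done none .right g
      | some x => onTape t .back (some x) .left g
    | .done, _, _ => none

theorem tape_append_length (u l : List Bool) : tape (u ++ l) u.length = l[0]? := by
  simp [tape, List.getElem?_append_right]

theorem update_tape_append (u l : List Bool) (y : Bool) :
    Function.update (tape (u ++ l)) u.length (some y) = tape (u ++ y :: l.tail) := by
  funext i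
  rcases eq_or_ne i u.length with rfl | hi
  · simp [tape]
  · rw [Function.update_of_ne hi]
    unfold tape
    split_ifs with h
    · rcases lt_or_ge i.toNat u.length with h' | h'
      · rw [List.getElem?_append_left h', List.getElem?_append_left h']
      · rw [List.getElem?_append_right h', List.getElem?_append_right h']
        obtain ⟨j, hj⟩ : ∃ j, i.toNat - u.length = j + 1 := ⟨i.toNat - u.length - 1, by omega⟩
        simp [hj]
    · rfl

theorem update_tape_concat (u : List Bool) (x : Bool) :
    Function.update (tape (u ++ [x])) u.length none = tape u := by
  funext i
  rcases eq_or_ne i u.length with rfl | hi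
  · simp [tape]
  · rw [Function.update_of_ne hi]
    unfold tape
    split_ifs with h
    · rcases lt_or_ge i.toNat u.length with h' | h'
      · rw [List.getElem?_append_left h']
      · rw [List.getElem?_eq_none (l := u) h', List.getElem?_eq_none]
        simp only [List.length_append, List.length_singleton]
        omega
    · rfl

/-- The configuration in which, other than in `conf`, the tape `t` holds the word `l` and has its
head at `h`. -/
def confAt (D : Type*) (up : Bool) (t : Fin k) (q : Phase) (p : ℕ) (c : Fin k → ℕ)
    (o : List (P ⊕ D)) (h : ℤ) (l : List Bool) :
    (count up t : Routine P k).toTransducer.Cfg D where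
  state := q
  inputPos := p
  workPos := Function.update (fun _ => 0) t h
  work := Function.update (fun t => tape (digits (c t))) t (tape l)
  output := o

theorem confAt_eq_conf {up : Bool} {t : Fin k} {q : Phase} {p : ℕ} {c : Fin k → ℕ}
    {o : List (P ⊕ D)} {v : ℕ} :
    confAt D up t q p c o 0 (digits v) = conf D (count up t) q p (Function.update c t v) o := by
  have h1 : Function.update (fun _ => (0 : ℤ)) t 0 = fun _ => 0 :=
    Function.update_eq_self t (fun _ => (0 : ℤ))
  have h2 : Function.update (fun t => tape (digits (c t))) t (tape (digits v)) =
      fun s => tape (digits (Function.update c t v s)) := by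
    funext s
    rcases eq_or_ne s t with rfl | hs
    · simp
    · simp [hs]
  unfold confAt conf
  rw [h1, h2]

variable {z : List D} {w : List (P ⊕ D)} {p : ℕ} {c : Fin k → ℕ} {o : List (P ⊕ D)} {up : Bool}
  {t : Fin k} {h : ℤ} {l l' : List Bool}

/-- Prepend one step of a counter update to a run. -/
theorem Leads.head_confAt {q q' : Phase} {y : Option Bool} {m : Move}
    {s : ((count up t : Routine P k).toTransducer).Cfg D}
    (hδ : ∀ sc g, g t = tape l h → (count up t : Routine P k).δ q sc g = some (onTape t q' y m g))
    (hl : Function.update (tape l) h y = tape l')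
    (hh : |h| ≤ (Nat.log 2 w.length + 1 : ℕ))
    (hs : Leads z w (confAt D up t q' p c o (Transducer.moveWork m h) l') s) :
    Leads z w (confAt D up t q p c o h l) s := by
  refine Relation.ReflTransGen.head ⟨?_, ?_⟩ hs
  · unfold Transducer.step
    rw [Option.map_eq_some_iff]
    refine ⟨_, hδ _ _ (by simp [confAt]), ?_⟩
    have h1 : (fun r => Transducer.moveWork (Function.update (fun _ => Move.stay) t m r)
        (Function.update (fun _ => (0 : ℤ)) t h r)) =
        Function.update (fun _ => (0 : ℤ)) t (Transducer.moveWork m h) := by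
      funext r
      rcases eq_or_ne r t with rfl | hr
      · simp
      · simp [hr, Transducer.moveWork]
    have h2 : (fun r => Function.update
        (Function.update (fun t => tape (digits (c t))) t (tape l) r)
        (Function.update (fun _ => (0 : ℤ)) t h r)
        (Function.update (fun r => Function.update (fun t => tape (digits (c t))) t (tape l) r
          (Function.update (fun _ => (0 : ℤ)) t h r)) t y r)) =
        Function.update (fun t => tape (digits (c t))) t (tape l') := by
      funext r
      rcases eq_or_ne r t with rfl | hr
      · simp [hl]
      · simp [hr]
    simp only [confAt, onTape, Transducer.moveInput, Transducer.emitted, List.append_nil, h1, h2]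
  · intro r
    change |Function.update (fun _ => (0 : ℤ)) t h r| ≤ _
    by_cases hr : r = t
    · rw [hr, Function.update_self]
      exact hh
    · rw [Function.update_of_ne hr, abs_zero]
      positivity

theorem leads_back (n : ℕ) (hn : n ≤ l.length) (hl : l.length ≤ Nat.log 2 w.length + 1) :
    Leads z w (confAt D up t .back p c o ((n : ℤ) - 1) l)
      (confAt D up t .done p c o 0 l) := by
  induction n with
  | zero =>
    refine Leads.head_confAt (l' := l) (q' := .done) (y := none) (m := .right) ?_ ?_ ?_ ?_
    · intro sc g hg
      simp [count, hg, tape]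
    · rw [Function.update_eq_iff]
      simp [tape]
    · simp
    · exact .refl
  | succ n ih =>
    have hx : tape l ((n + 1 : ℕ) - 1 : ℤ) = some l[n] := by
      simp [tape]
    refine Leads.head_confAt (l' := l) (q' := .back) (y := some l[n]) (m := .left) ?_ ?_ ?_ ?_
    · intro sc g hg
      rw [hx] at hg
      simp [count, hg]
    · rw [Function.update_eq_iff]
      exact ⟨hx.symm, fun _ _ => rfl⟩
    · rw [abs_le]; push_cast; omega
    · convert ih (by omega) using 2
      simp [Transducer.moveWork]

/-- The increment has already flipped the digits `u`, and continues at the first digit of `l`. -/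
theorem leads_carry_up (l u : List Bool)
    (hu : (u ++ succDigits l).length ≤ Nat.log 2 w.length + 1) :
    Leads z w (confAt D true t .carry p c o u.length (u ++ l))
      (confAt D true t .done p c o 0 (u ++ succDigits l)) := by
  induction l generalizing u with
  | nil =>
    refine Leads.head_confAt (q' := .back) (y := some false) (m := .left) ?_
      (update_tape_append u _ false) ?_ (leads_back u.length (by simp) hu)
    · intro sc g hg
      rw [tape_append_length] at hg
      simp [count, hg]
    · simp [succDigits] at hu ⊢; omega
  | cons x l ih =>
    have hw : |(u.length : ℤ)| ≤ (Nat.log 2 w.length + 1 : ℕ) := by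
      rw [List.length_append] at hu
      rw [Nat.abs_cast]
      exact_mod_cast le_trans (Nat.le_add_right _ _) hu
    cases x
    · refine Leads.head_confAt (q' := .back) (y := some true) (m := .left) ?_
        (update_tape_append u _ true) hw (leads_back u.length (by simp) hu)
      intro sc g hg
      rw [tape_append_length] at hg
      simp at hg
      simp [count, hg]
    · refine Leads.head_confAt (q' := .carry) (y := some false) (m := .right) ?_
        (update_tape_append u _ false) hw ?_
      · intro sc g hg
        rw [tape_append_length] at hg
        simp at hg
        simp [count, hg]
      · have := ih (u ++ [false]) (by simpa [succDigits] using hu)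
        simpa [succDigits, Transducer.moveWork] using this

/-- The decrement has already flipped the digits `u`, and continues at the first digit of `l`. -/
theorem leads_carry_down (l u : List Bool) (h0 : l ≠ [])
    (hu : (u ++ l).length ≤ Nat.log 2 w.length + 1) :
    Leads z w (confAt D false t .carry p c o u.length (u ++ l))
      (confAt D false t .done p c o 0 (u ++ predDigits l)) := by
  induction l generalizing u with
  | nil => exact absurd rfl h0
  | cons x l ih =>
    have hw : |(u.length : ℤ)| ≤ (Nat.log 2 w.length + 1 : ℕ) := by
      rw [List.length_append] at hu
      rw [Nat.abs_cast]
      exact_mod_cast le_trans (Nat.le_add_right _ _) hu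
    cases x
    · refine Leads.head_confAt (q' := .carry) (y := some true) (m := .right) ?_
        (update_tape_append u _ true) hw ?_
      · intro sc g hg
        rw [tape_append_length] at hg
        simp at hg
        simp [count, hg]
      · rcases l with _ | ⟨y, l⟩
        · -- the leading digit has been borrowed from, and has to vanish
          refine Leads.head_confAt (q' := .erase) (y := none) (m := .left) (l' := u ++ [true])
            ?_ ?_ ?_ ?_
          · intro sc g hg
            have : g t = none := by
              rw [hg]
              simp [Transducer.moveWork, tape]
            simp [count, this]
          · rw [Function.update_eq_iff]
            simp [Transducer.moveWork, tape]
          · simp at hu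
            rw [abs_le]
            simp [Transducer.moveWork]
            omega
          · refine Leads.head_confAt (q' := .back) (y := none) (m := .left) (l' := u) ?_ ?_ ?_ ?_
            · intro sc g hg
              simp [count]
            · simpa [Transducer.moveWork] using update_tape_concat u true
            · simpa [Transducer.moveWork] using hw
            · simpa [Transducer.moveWork, predDigits] using
                leads_back (l := u) u.length le_rfl (by simp at hu; omega)
        · have := ih (u ++ [true]) (by simp) (by simpa using hu)
          simpa [predDigits, Transducer.moveWork] using this
    · refine Leads.head_confAt (q' := .back) (y := some false) (m := .left) ?_
        (update_tape_append u _ false) hw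
        (leads_back u.length (by simp) (by simpa [predDigits] using hu))
      intro sc g hg
      rw [tape_append_length] at hg
      simp at hg
      simp [count, hg]

/-- Add 1 to a counter. -/
abbrev inc (t : Fin k) : Routine P k := count true t

/-- Subtract 1 from a counter. -/
abbrev dec (t : Fin k) : Routine P k := count false t

theorem exec_inc (ht : c t + 1 ≤ w.length) :
    Exec z w (inc t) p c [] p (Function.update c t (c t + 1)) := by
  intro o₀
  rw [List.append_nil]
  refine ⟨Phase.done, ?_, rfl⟩
  have h := leads_carry_up (z := z) (w := w) (p := p) (c := c) (o := o₀) (t := t)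
    (digits (c t)) [] (by rw [← digits_succ]; exact length_digits_le ht)
  simp only [List.nil_append, ← digits_succ, List.length_nil, Nat.cast_zero] at h
  rw [confAt_eq_conf, confAt_eq_conf, Function.update_eq_self] at h
  exact h

theorem exec_dec {v : ℕ} (hv : c t = v + 1) (ht : c t ≤ w.length) :
    Exec z w (dec t) p c [] p (Function.update c t v) := by
  intro o₀
  rw [List.append_nil]
  refine ⟨Phase.done, ?_, rfl⟩
  have h := leads_carry_down (z := z) (w := w) (p := p) (c := c) (o := o₀) (t := t)
    (digits (c t)) [] (by rw [hv, digits_succ]; exact succDigits_ne_nil _) (length_digits_le ht)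
  have hd : predDigits (digits (c t)) = digits v := by rw [hv, digits_succ, predDigits_succDigits]
  simp only [List.nil_append, List.length_nil, Nat.cast_zero, hd] at h
  rw [confAt_eq_conf, confAt_eq_conf, Function.update_eq_self] at h
  exact h

end Routine

/-! ### Basic routines -/

namespace Routine

infixr:65 " ⨾ " => Routine.seq

variable {P : Type} {k : ℕ} {D : Type*}

/-- Counter `t` is nonzero. -/
abbrev nonzero (t : Fin k) : Test P k := fun _ g => g t

/-- The scanned input cell has the property `S`. -/
abbrev sees (S : Scan P → Bool) : Test P k := fun sc _ => S sc

/-- Move the input head to the right. -/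
abbrev right : Routine P k := act .right .nothing

/-- Move the input head to the left. -/
abbrev left : Routine P k := act .left .nothing

/-- Emit a delimiter. -/
abbrev put (a : P) : Routine P k := act .stay (.delim a)

/-- Emit the code of `0`. -/
abbrev putZero : Routine P k := act .stay .zero

/-- Move right to the first cell with property `S`, possibly not at all. -/
abbrev seekRight (S : Scan P → Bool) : Routine P k := loop (sees fun sc => !S sc) right

/-- Move left to the closest position whose left neighbour has property `S`. -/
abbrev seekLeft (S : Scan P → Bool) : Routine P k :=
  left ⨾ loop (sees fun sc => !S sc) left ⨾ right

/-- Add counter `s` to counter `t`, and reset `s`. -/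
abbrev transfer (s t : Fin k) : Routine P k := loop (nonzero s) (dec s ⨾ inc t)

/-- How the control sees a symbol of the input. -/
def look : P ⊕ D → Scan P
  | .inl a => .delim a
  | .inr _ => .datum

@[simp] theorem look_inl (a : P) : look (.inl a : P ⊕ D) = .delim a := rfl

@[simp] theorem look_inr (x : D) : look (.inr x : P ⊕ D) = .datum := rfl

theorem scan_append_cons (u v : List (P ⊕ D)) (x : P ⊕ D) :
    Transducer.scan (u ++ x :: v) (u.length + 1) = look x := by
  cases x <;> simp [Transducer.scan, look]

theorem scan_length_add_one (w : List (P ⊕ D)) :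
    Transducer.scan w (w.length + 1) = .rightEnd := by
  simp [Transducer.scan]

variable {z : List D} {w : List (P ⊕ D)} {p p' : ℕ} {c c' : Fin k → ℕ} {u v : List (P ⊕ D)}
  {S : Scan P → Bool}

theorem scan_of_eq_append_cons {x : P ⊕ D} (hw : w = u ++ x :: v) :
    Transducer.scan w (u.length + 1) = look x := by
  rw [hw, scan_append_cons]

theorem scan_of_eq_concat_append {x : P ⊕ D} (hw : w = (u ++ [x]) ++ v) :
    Transducer.scan w (u ++ [x]).length = look x := by
  rw [List.length_append, List.length_singleton]
  exact scan_of_eq_append_cons (v := v) (by simp [hw])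

theorem exec_right {x : P ⊕ D} (hw : w = u ++ x :: v) :
    Exec z w right (u.length + 1) c [] ((u ++ [x]).length + 1) c := by
  have h := exec_act (z := z) (w := w) (p := u.length + 1) (c := c) .right .nothing
  have hm : min (u.length + 1 + 1) (w.length + 1) = (u ++ [x]).length + 1 := by
    simp [hw]
  simpa only [Transducer.emitted, Transducer.moveInput, hm] using h

theorem exec_put (a : P) : Exec z w (put a) p c [.inl a] p c :=
  exec_act .stay (.delim a)

theorem exec_putZero : Exec z w putZero p c (z.map .inr) p c :=
  exec_act .stay .zero

theorem exec_copy {x : D} (hw : w = u ++ .inr x :: v) :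
    Exec z w (act .right .copy) (u.length + 1) c [.inr x] ((u ++ [Sum.inr x]).length + 1) c := by
  have h := exec_act (z := z) (w := w) (p := u.length + 1) (c := c) .right .copy
  have hm : min (u.length + 1 + 1) (w.length + 1) = (u ++ [Sum.inr x]).length + 1 := by
    simp [hw]
  have hx : w[u.length]? = some (.inr x) := by simp [hw]
  simpa only [Transducer.emitted, Transducer.moveInput, hm, hx] using h

theorem exec_seekRight (x : List (P ⊕ D)) (hw : w = u ++ (x ++ v))
    (hx : ∀ a ∈ x, S (look a) = false)
    (hS : S (Transducer.scan w ((u ++ x).length + 1)) = true) :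
    Exec z w (seekRight S) (u.length + 1) c [] ((u ++ x).length + 1) c := by
  induction x generalizing u with
  | nil =>
    rw [List.append_nil] at hS ⊢
    exact .loop_neg (by simp [hS])
  | cons a x ih =>
    refine .loop_pos_silent ?_ (exec_right hw) ?_
    · simp [scan_of_eq_append_cons hw, hx a (by simp)]
    · have := ih (u := u ++ [a]) (by simp [hw]) (fun b hb => hx b (by simp [hb]))
        (by simpa using hS)
      simpa using this

theorem exec_seekLeft (x : List (P ⊕ D)) (hw : w = u ++ (x ++ v))
    (hx : ∀ a ∈ x, S (look a) = false) (hS : S (Transducer.scan w u.length) = true) :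
    Exec z w (seekLeft S) ((u ++ x).length + 1) c [] (u.length + 1) c := by
  have hl (m : ℕ) : Exec z w left (m + 1) c [] m c :=
    exec_act .left .nothing
  have hr : Exec z w right u.length c [] (u.length + 1) c := by
    have h := exec_act (z := z) (w := w) (p := u.length) (c := c) .right .nothing
    have hm : min (u.length + 1) (w.length + 1) = u.length + 1 := by simp [hw]
    simpa only [Transducer.emitted, Transducer.moveInput, hm] using h
  have hloop : Exec z w (loop (sees fun sc => !S sc) left) (u ++ x).length c [] u.length c := by
    induction x using List.reverseRecOn generalizing v with
    | nil =>
      rw [List.append_nil]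
      exact .loop_neg (by simp [hS])
    | append_singleton x a ih =>
      rw [← List.append_assoc]
      refine .loop_pos_silent ?_ (p' := (u ++ x).length) ?_
        (ih (v := a :: v) (by simp [hw]) fun b hb => hx b (by simp [hb]))
      · rw [scan_of_eq_concat_append (v := v) (by simp [hw])]
        simp [hx a (by simp)]
      · rw [List.length_append (bs := [a])]
        exact hl _
  exact (hl _).seq_silent (hloop.seq_silent hr)

theorem exec_inc_to {t : Fin k} (ht : c t + 1 ≤ w.length)
    (hc : Function.update c t (c t + 1) = c') : Exec z w (inc t) p c [] p c' :=
  hc ▸ exec_inc ht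

theorem exec_dec_to {t : Fin k} {n : ℕ} (hn : c t = n + 1) (ht : c t ≤ w.length)
    (hc : Function.update c t n = c') : Exec z w (dec t) p c [] p c' :=
  hc ▸ exec_dec hn ht

theorem exec_transfer {s t : Fin k} (hst : s ≠ t) (h : c t + c s ≤ w.length) :
    Exec z w (transfer s t) p c [] p
      (Function.update (Function.update c s 0) t (c t + c s)) := by
  obtain ⟨n, hn⟩ : ∃ n, c s = n := ⟨_, rfl⟩
  induction n generalizing c with
  | zero =>
    have : Function.update (Function.update c s 0) t (c t + c s) = c := by
      rw [hn, add_zero, ← hn, Function.update_eq_self, Function.update_eq_self]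
    rw [this]
    exact .loop_neg (by simp [hn])
  | succ n ih =>
    have hc : Function.update (Function.update (Function.update (Function.update c s n) t
        (c t + 1)) s 0) t (c t + 1 + n) =
        Function.update (Function.update c s 0) t (c t + c s) := by
      funext r
      by_cases hr : r = t
      · subst hr
        simp only [Function.update_self]
        omega
      · by_cases hs : r = s
        · subst hs
          simp [hr]
        · simp [hr, hs]
    have hs : Function.update (Function.update c s n) t (c t + 1) s = n := by simp [hst]
    have hi := ih (c := Function.update (Function.update c s n) t (c t + 1))
      (by rw [hs, Function.update_self]; omega) hs
    rw [hs, Function.update_self, hc] at hi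
    refine .loop_pos_silent (by simp [hn]) ((exec_dec hn (by omega)).seq_silent
      (exec_inc_to ?_ ?_)) hi
    · rw [Function.update_of_ne hst.symm]
      omega
    · rw [Function.update_of_ne hst.symm]

theorem exec_transfer_to {s t : Fin k} (hst : s ≠ t) (h : c t + c s ≤ w.length)
    (hc : Function.update (Function.update c s 0) t (c t + c s) = c') :
    Exec z w (transfer s t) p c [] p c' :=
  hc ▸ exec_transfer hst h

end Routine

/-! ### The transducer that writes out the Toeplitz blocks -/

namespace Routine

/-- The scanned cell holds the given mark. -/
def isMark : Delim → Scan Delim → Bool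
  | .coeffEnd, .delim .coeffEnd => true
  | .entryEnd, .delim .entryEnd => true
  | .rowEnd, .delim .rowEnd => true
  | .matrixEnd, .delim .matrixEnd => true
  | _, _ => false

/-- The scanned cell holds a data symbol. -/
def isDatum : Scan Delim → Bool
  | .datum => true
  | _ => false

/-- The scanned cell holds the left endmarker. -/
def isLeftEnd : Scan Delim → Bool
  | .leftEnd => true
  | _ => false

/-- The cell to the right of the scanned one may be the first cell of a matrix entry. -/
def precedesEntry : Scan Delim → Bool
  | .leftEnd => true
  | .delim .entryEnd => true
  | .delim .rowEnd => true
  | .delim .matrixEnd => true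
  | _ => false

/-- The cell to the right of the scanned one may be the first cell of a row. -/
def precedesRow : Scan Delim → Bool
  | .leftEnd => true
  | .delim .rowEnd => true
  | .delim .matrixEnd => true
  | _ => false

/-- The scanned cell holds the end of a row, or the right endmarker. -/
def isRowEnd : Scan Delim → Bool
  | .rightEnd => true
  | .delim .rowEnd => true
  | _ => false

/-- Started with `i` in counter 1 and `0` in counter 3 at the first cell of an entry, skip the
coefficients of `x^0, …, x^(i-1)`, as far as they are there, and move `i` to counter 3. -/
abbrev skipCoeffs : Routine Delim 4 :=
  loop (nonzero 1) (dec 1 ⨾ inc 3 ⨾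
    cond (sees (isMark .entryEnd)) skip (seekRight (isMark .coeffEnd) ⨾ right))

/-- Started at the first cell of a coefficient, or at the end of an entry, emit that coefficient, or
the code of `0`. -/
def putCoeff : Routine Delim 4 :=
  cond (sees (isMark .entryEnd)) putZero (loop (sees isDatum) (act .right .copy))

/-- Started with `i` in counter 1 and `0` in counter 3 at the first cell of an entry, emit the
coefficient of `x^i` as an entry over `R`, and restore the counters and the position. -/
def putCoeffAt : Routine Delim 4 :=
  skipCoeffs ⨾ putCoeff ⨾ put .entryEnd ⨾ seekLeft precedesEntry ⨾ transfer 3 1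

/-- Started with counters `T - 1 - a, a + 1, 0, 0` at the first cell of an entry, emit row `a` of
its `T × T` block, and go to the next entry. The first loop emits the `a + 1` entries up to the
diagonal, and the second one the `T - 1 - a` zeros behind it. -/
def putBlockRow : Routine Delim 4 :=
  loop (nonzero 1) (dec 1 ⨾ inc 2 ⨾ putCoeffAt) ⨾ transfer 2 1 ⨾
    loop (nonzero 0) (dec 0 ⨾ inc 3 ⨾ putZero ⨾ put .entryEnd) ⨾ transfer 3 0 ⨾
    seekRight (isMark .entryEnd) ⨾ right

/-- Started with counters `T, 0, 0, 0` at the first cell of a row, emit the `T` rows that replace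
it, and go behind the row. -/
def putRows : Routine Delim 4 :=
  loop (nonzero 0) (dec 0 ⨾ inc 1 ⨾ loop (sees fun sc => !isMark .rowEnd sc) putBlockRow ⨾
    put .rowEnd ⨾ seekLeft precedesRow) ⨾ transfer 1 0 ⨾ seekRight (isMark .rowEnd) ⨾ right

/-- Started with counters `T, 0, 0, 0` at the first cell of a matrix, emit its block matrix, and go
behind the matrix. -/
def putMatrix : Routine Delim 4 :=
  loop (sees fun sc => !isMark .matrixEnd sc) putRows ⨾ put .matrixEnd ⨾ right

/-- Count the coefficients in the first row of the input, and return to the first cell. -/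
def countCoeffs : Routine Delim 4 :=
  right ⨾ loop (sees fun sc => !isRowEnd sc)
    (cond (sees (isMark .coeffEnd)) (inc 0) skip ⨾ right) ⨾ seekLeft isLeftEnd

/-- The number `T` of coefficients in the first row is the size of the blocks. It is kept in
counter 0, and then the matrices are processed one by one. -/
def putToeplitz : Routine Delim 4 :=
  countCoeffs ⨾ loop (sees fun sc => match sc with | .rightEnd => false | _ => true) putMatrix

variable {D : Type*} {z : List D} {w u v : List (Delim ⊕ D)} {t n y x : ℕ}

/-- The word for a coefficient with code `a`. -/
def coeffWord (a : List D) : List (Delim ⊕ D) := a.map .inr ++ [.inl .coeffEnd]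

/-- The word for an entry, given by the codes of its coefficients. -/
def entryWord (e : List (List D)) : List (Delim ⊕ D) := e.flatMap coeffWord ++ [.inl .entryEnd]

/-- The word for a row. -/
def rowWord (r : List (List (List D))) : List (Delim ⊕ D) := r.flatMap entryWord ++ [.inl .rowEnd]

/-- The word for a matrix. -/
def matrixWord (m : List (List (List (List D)))) : List (Delim ⊕ D) :=
  m.flatMap rowWord ++ [.inl .matrixEnd]

/-- The word for the element of `R` that is the coefficient of `x^i`, as a matrix entry. -/
def coeffOut (z : List D) (e : List (List D)) (i : ℕ) : List (Delim ⊕ D) :=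
  (e.getD i z).map .inr ++ [.inl .entryEnd]

/-- The word for row `a` of the block that replaces an entry: the coefficients of
`x^a, …, x^0`, and then zeros. -/
def blockRowOut (z : List D) (T a : ℕ) (e : List (List D)) : List (Delim ⊕ D) :=
  (List.range (a + 1)).reverse.flatMap (coeffOut z e) ++
    (List.range (T - 1 - a)).flatMap fun _ => z.map .inr ++ [.inl .entryEnd]

/-- The word for row `a` of the blocks that replace the entries of a row. -/
def rowOut (z : List D) (T : ℕ) (r : List (List (List D))) (a : ℕ) : List (Delim ⊕ D) :=
  r.flatMap (blockRowOut z T a) ++ [.inl .rowEnd]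

/-- The word for the block matrix that replaces a matrix. -/
def matrixOut (z : List D) (T : ℕ) (m : List (List (List (List D)))) : List (Delim ⊕ D) :=
  (m.flatMap fun r => (List.range T).flatMap (rowOut z T r)) ++ [.inl .matrixEnd]

theorem entryWord_eq_cons (e : List (List D)) :
    ∃ x v, entryWord e = x :: v ∧ isMark .rowEnd (look x) = false := by
  rcases e with _ | ⟨_ | ⟨_, _⟩, _⟩ <;> exact ⟨_, _, rfl, rfl⟩

theorem rowWord_eq_cons (r : List (List (List D))) :
    ∃ x v, rowWord r = x :: v ∧ isMark .matrixEnd (look x) = false := by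
  rcases r with _ | ⟨_ | ⟨_ | ⟨_, _⟩, _⟩, _⟩ <;> exact ⟨_, _, rfl, rfl⟩

theorem update_vec4_zero (a b c d e : ℕ) : Function.update ![a, b, c, d] 0 e = ![e, b, c, d] := by
  funext i; fin_cases i <;> rfl

theorem update_vec4_one (a b c d e : ℕ) : Function.update ![a, b, c, d] 1 e = ![a, e, c, d] := by
  funext i; fin_cases i <;> rfl

theorem update_vec4_two (a b c d e : ℕ) : Function.update ![a, b, c, d] 2 e = ![a, b, e, d] := by
  funext i; fin_cases i <;> rfl

theorem update_vec4_three (a b c d e : ℕ) :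
    Function.update ![a, b, c, d] 3 e = ![a, b, c, e] := by
  funext i; fin_cases i <;> rfl

attribute [local simp] update_vec4_zero update_vec4_one update_vec4_two update_vec4_three

/-- If there are fewer than `x` coefficients, the head stops at the end of the entry. -/
theorem exec_skipCoeffs (e : List (List D))
    (hw : w = u ++ (e.flatMap coeffWord ++ .inl .entryEnd :: v)) (hx : x + y ≤ w.length) :
    Exec z w skipCoeffs (u.length + 1) ![t, x, n, y] []
      ((u ++ (e.take x).flatMap coeffWord).length + 1) ![t, 0, n, y + x] := by
  induction x generalizing u e y with
  | zero => simpa using Exec.loop_neg (by simp)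
  | succ x ih =>
    have h1 : Exec z w (dec 1) (u.length + 1) ![t, x + 1, n, y] [] (u.length + 1) ![t, x, n, y] :=
      exec_dec_to (n := x) (by simp) (by simp; omega) (by simp)
    have h2 : Exec z w (inc 3) (u.length + 1) ![t, x, n, y] [] (u.length + 1) ![t, x, n, y + 1] :=
      exec_inc_to (by simp; omega) (by simp)
    rcases e with _ | ⟨a, e⟩
    · have := ih (u := u) (y := y + 1) [] hw (by omega)
      refine .loop_pos_silent (by simp) (h1.seq_silent (h2.seq_silent (.cond_pos ?_ exec_skip))) ?_
      · simp [scan_of_eq_append_cons (by simpa using hw), isMark]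
      · simpa [add_assoc, add_comm 1] using this
    · have h3 : Exec z w (seekRight (isMark .coeffEnd)) (u.length + 1) ![t, x, n, y + 1] []
          ((u ++ a.map Sum.inr).length + 1) ![t, x, n, y + 1] := by
        refine exec_seekRight (v := .inl .coeffEnd :: (e.flatMap coeffWord ++ .inl .entryEnd :: v))
          _ (by simp [hw, coeffWord]) (by simp [isMark]) ?_
        rw [scan_of_eq_append_cons (x := .inl .coeffEnd)
          (v := e.flatMap coeffWord ++ .inl .entryEnd :: v) (by simp [hw, coeffWord])]
        rfl
      have h4 : Exec z w right ((u ++ a.map Sum.inr).length + 1) ![t, x, n, y + 1] []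
          ((u ++ coeffWord a).length + 1) ![t, x, n, y + 1] := by
        have := exec_right (z := z) (w := w) (c := ![t, x, n, y + 1]) (u := u ++ a.map Sum.inr)
          (x := .inl .coeffEnd) (v := e.flatMap coeffWord ++ .inl .entryEnd :: v)
          (by simp [hw, coeffWord])
        simpa only [coeffWord, List.append_assoc] using this
      refine .loop_pos_silent (by simp) (h1.seq_silent (h2.seq_silent (.cond_neg ?_
        (h3.seq_silent h4)))) ?_
      · rcases a with _ | ⟨b, a⟩
        · simp [scan_of_eq_append_cons (by simpa [coeffWord] using hw), isMark]
        · simp [scan_of_eq_append_cons (by simpa [coeffWord] using hw), isMark]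
      · have := ih (u := u ++ coeffWord a) (y := y + 1) e (by simp [hw]) (by omega)
        simpa [add_assoc, add_comm 1] using this

theorem exec_copyCoeff (a : List D) {b : Delim} {c : Fin 4 → ℕ}
    (hw : w = u ++ (a.map Sum.inr ++ .inl b :: v)) :
    Exec z w (loop (sees isDatum) (act .right .copy)) (u.length + 1) c (a.map Sum.inr)
      ((u ++ a.map Sum.inr).length + 1) c := by
  induction a generalizing u with
  | nil =>
    have hs : Transducer.scan w (u.length + 1) = .delim b :=
      scan_of_eq_append_cons (by simpa using hw)
    simpa using Exec.loop_neg (by simp [hs, isDatum])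
  | cons x a ih =>
    have hw' : w = u ++ .inr x :: (a.map Sum.inr ++ .inl b :: v) := by simpa using hw
    have := (ih (u := u ++ [Sum.inr x]) (by simp [hw]))
    have := Exec.loop_pos (test := sees isDatum)
      (by simp [scan_of_eq_append_cons hw', isDatum]) (exec_copy hw') this
    simpa using this

/-- Here `e` are the remaining coefficients of the entry. -/
theorem exec_putCoeff (e : List (List D)) {c : Fin 4 → ℕ}
    (hw : w = u ++ (e.flatMap coeffWord ++ .inl .entryEnd :: v)) :
    Exec z w putCoeff (u.length + 1) c ((e.headD z).map Sum.inr)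
      ((u ++ (e.headD []).map Sum.inr).length + 1) c := by
  rcases e with _ | ⟨a, e⟩
  · refine .cond_pos ?_ (by simpa using exec_putZero)
    simp [scan_of_eq_append_cons (by simpa using hw), isMark]
  · refine .cond_neg ?_ (exec_copyCoeff (b := .coeffEnd)
      (v := e.flatMap coeffWord ++ .inl .entryEnd :: v) a (by simp [hw, coeffWord]))
    rcases a with _ | ⟨b, a⟩
    · simp [scan_of_eq_append_cons (by simpa [coeffWord] using hw), isMark]
    · simp [scan_of_eq_append_cons (by simpa [coeffWord] using hw), isMark]

theorem exec_putCoeffAt (e : List (List D))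
    (hw : w = u ++ (e.flatMap coeffWord ++ .inl .entryEnd :: v)) (hx : x ≤ w.length)
    (hu : precedesEntry (Transducer.scan w u.length) = true) :
    Exec z w putCoeffAt (u.length + 1) ![t, x, n, 0] (coeffOut z e x) (u.length + 1)
      ![t, x, n, 0] := by
  have hsplit : e.flatMap coeffWord =
      (e.take x).flatMap coeffWord ++ (e.drop x).flatMap coeffWord := by
    rw [← List.flatMap_append, List.take_append_drop]
  have h1 := exec_skipCoeffs (z := z) (t := t) (x := x) (n := n) (y := 0) e hw (by simpa using hx)
  rw [zero_add] at h1
  have h2 := exec_putCoeff (z := z) (w := w) (u := u ++ (e.take x).flatMap coeffWord) (v := v)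
    (e.drop x) (c := ![t, 0, n, x]) (by rw [hw, hsplit]; simp)
  have h3 : Exec z w (seekLeft precedesEntry) ((u ++ (e.take x).flatMap coeffWord ++
      ((e.drop x).headD []).map Sum.inr).length + 1) ![t, 0, n, x] [] (u.length + 1)
      ![t, 0, n, x] := by
    obtain ⟨v', hv'⟩ : ∃ v', (e.drop x).flatMap coeffWord ++ .inl .entryEnd :: v =
        ((e.drop x).headD []).map Sum.inr ++ v' := by
      rcases e.drop x with _ | ⟨a, e'⟩
      · exact ⟨_, rfl⟩
      · exact ⟨.inl .coeffEnd :: (e'.flatMap coeffWord ++ .inl .entryEnd :: v),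
          by simp [coeffWord]⟩
    rw [List.append_assoc]
    refine exec_seekLeft (v := v') _ ?_ ?_ hu
    · rw [hw, hsplit, List.append_assoc, List.append_assoc, hv']
    · intro b hb
      simp only [List.mem_append, List.mem_flatMap, coeffWord, List.mem_map,
        List.mem_singleton] at hb
      rcases hb with ⟨_, _, ⟨_, _, rfl⟩ | rfl⟩ | ⟨_, _, rfl⟩ <;> rfl
  have h4 : Exec z w (transfer 3 1) (u.length + 1) ![t, 0, n, x] [] (u.length + 1)
      ![t, x, n, 0] :=
    exec_transfer_to (by decide) (by simpa using hx) (by simp)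
  have hh : (e.drop x).headD z = e.getD x z := by
    simp [List.headD_eq_head?_getD, List.getD_eq_getElem?_getD]
  rw [hh] at h2
  simpa only [putCoeffAt, coeffOut, List.append_nil] using
    h1.seq_silent (h2.seq ((exec_put _).seq (h3.seq h4)))

theorem exec_putCoeffs (e : List (List D))
    (hw : w = u ++ (e.flatMap coeffWord ++ .inl .entryEnd :: v)) (hx : n + y ≤ w.length)
    (hu : precedesEntry (Transducer.scan w u.length) = true) :
    Exec z w (loop (nonzero 1) (dec 1 ⨾ inc 2 ⨾ putCoeffAt)) (u.length + 1) ![t, n, y, 0]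
      ((List.range n).reverse.flatMap (coeffOut z e)) (u.length + 1) ![t, 0, y + n, 0] := by
  induction n generalizing y with
  | zero => simpa using Exec.loop_neg (by simp)
  | succ n ih =>
    have h1 : Exec z w (dec 1) (u.length + 1) ![t, n + 1, y, 0] [] (u.length + 1) ![t, n, y, 0] :=
      exec_dec_to (n := n) (by simp) (by simp; omega) (by simp)
    have h2 : Exec z w (inc 2) (u.length + 1) ![t, n, y, 0] [] (u.length + 1) ![t, n, y + 1, 0] :=
      exec_inc_to (by simp; omega) (by simp)
    have h3 := exec_putCoeffAt (z := z) (t := t) (x := n) (n := y + 1) e hw (by omega) hu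
    have := Exec.loop_pos (test := nonzero 1) (by simp)
      (h1.seq_silent (h2.seq_silent h3)) (ih (y := y + 1) (by omega))
    simpa [List.range_succ, add_assoc, add_comm 1] using this

theorem exec_putZeros {p : ℕ} (hx : t + x ≤ w.length) :
    Exec z w (loop (nonzero 0) (dec 0 ⨾ inc 3 ⨾ putZero ⨾ put .entryEnd)) p ![t, n, y, x]
      ((List.range t).flatMap fun _ => z.map Sum.inr ++ [.inl .entryEnd]) p ![0, n, y, x + t] := by
  induction t generalizing x with
  | zero => simpa using Exec.loop_neg (by simp)
  | succ t ih =>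
    have h1 : Exec z w (dec 0) p ![t + 1, n, y, x] [] p ![t, n, y, x] :=
      exec_dec_to (n := t) (by simp) (by simp; omega) (by simp)
    have h2 : Exec z w (inc 3) p ![t, n, y, x] [] p ![t, n, y, x + 1] :=
      exec_inc_to (by simp; omega) (by simp)
    have := Exec.loop_pos (test := nonzero 0) (by simp)
      (h1.seq_silent (h2.seq_silent (exec_putZero.seq (exec_put _)))) (ih (x := x + 1) (by omega))
    simpa [List.range_succ_eq_map, List.flatMap_map, add_assoc, add_comm 1] using this

theorem exec_putBlockRow {T a : ℕ} (e : List (List D)) (hw : w = u ++ (entryWord e ++ v))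
    (ha : a < T) (hT : T ≤ w.length)
    (hu : precedesEntry (Transducer.scan w u.length) = true) :
    Exec z w putBlockRow (u.length + 1) ![T - 1 - a, a + 1, 0, 0] (blockRowOut z T a e)
      ((u ++ entryWord e).length + 1) ![T - 1 - a, a + 1, 0, 0] := by
  have hw' : w = u ++ (e.flatMap coeffWord ++ .inl .entryEnd :: v) := by
    simpa [entryWord] using hw
  have h1 := exec_putCoeffs (z := z) (t := T - 1 - a) (n := a + 1) (y := 0) e hw' (by omega) hu
  rw [zero_add] at h1
  have h2 : Exec z w (transfer 2 1) (u.length + 1) ![T - 1 - a, 0, a + 1, 0] [] (u.length + 1)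
      ![T - 1 - a, a + 1, 0, 0] :=
    exec_transfer_to (by decide) (by simp; omega) (by simp)
  have h3 := exec_putZeros (z := z) (w := w) (t := T - 1 - a) (n := a + 1) (y := 0) (x := 0)
    (p := u.length + 1) (by omega)
  rw [zero_add] at h3
  have h4 : Exec z w (transfer 3 0) (u.length + 1) ![0, a + 1, 0, T - 1 - a] [] (u.length + 1)
      ![T - 1 - a, a + 1, 0, 0] :=
    exec_transfer_to (by decide) (by simp; omega) (by simp)
  have h5 : Exec z w (seekRight (isMark .entryEnd)) (u.length + 1) ![T - 1 - a, a + 1, 0, 0] []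
      ((u ++ e.flatMap coeffWord).length + 1) ![T - 1 - a, a + 1, 0, 0] := by
    refine exec_seekRight _ hw' ?_ ?_
    · intro b hb
      simp only [List.mem_append, List.mem_flatMap, coeffWord, List.mem_map,
        List.mem_singleton] at hb
      rcases hb with ⟨_, _, ⟨_, _, rfl⟩ | rfl⟩ <;> rfl
    · rw [scan_of_eq_append_cons (by rw [hw', List.append_assoc])]
      rfl
  have h6 := exec_right (z := z) (w := w) (c := ![T - 1 - a, a + 1, 0, 0])
    (u := u ++ e.flatMap coeffWord)
    (x := .inl .entryEnd) (v := v) (by rw [hw', List.append_assoc])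
  have := h1.seq (h2.seq_silent (h3.seq (h4.seq (h5.seq h6))))
  simpa only [putBlockRow, blockRowOut, entryWord, List.append_nil, List.append_assoc] using this

theorem exec_putBlockRows {T a : ℕ} (r : List (List (List D)))
    (hw : w = u ++ (r.flatMap entryWord ++ .inl .rowEnd :: v))
    (ha : a < T) (hT : T ≤ w.length)
    (hu : precedesEntry (Transducer.scan w u.length) = true) :
    Exec z w (loop (sees fun sc => !isMark .rowEnd sc) putBlockRow) (u.length + 1)
      ![T - 1 - a, a + 1, 0, 0] (r.flatMap (blockRowOut z T a))
      ((u ++ r.flatMap entryWord).length + 1) ![T - 1 - a, a + 1, 0, 0] := by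
  induction r generalizing u with
  | nil =>
    have hs := scan_of_eq_append_cons (by simpa using hw)
    simpa using Exec.loop_neg (by simp [hs, isMark])
  | cons e r ih =>
    have h1 := exec_putBlockRow (z := z) (v := r.flatMap entryWord ++ .inl .rowEnd :: v) e
      (by simp [hw]) ha hT hu
    have h2 := ih (u := u ++ entryWord e) (by simp [hw]) (by
      rw [entryWord, ← List.append_assoc, scan_of_eq_concat_append
        (v := r.flatMap entryWord ++ .inl .rowEnd :: v) (by simp [hw, entryWord])]
      rfl)
    have hs : isMark .rowEnd (Transducer.scan w (u.length + 1)) = false := by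
      obtain ⟨x, v', hx, hx'⟩ := entryWord_eq_cons e
      rwa [scan_of_eq_append_cons (x := x) (v := v' ++ (r.flatMap entryWord ++ .inl .rowEnd :: v))
        (by simp [hw, hx])]
    have := Exec.loop_pos (test := sees fun sc => !isMark .rowEnd sc) (by simp [hs]) h1 h2
    simpa using this

theorem precedesEntry_of_precedesRow {sc : Scan Delim} (h : precedesRow sc = true) :
    precedesEntry sc = true := by
  rcases sc with _ | _ | (_ | _) | _ <;> first | rfl | cases h

theorem exec_seekLeft_row {c : Fin 4 → ℕ} (r : List (List (List D)))
    (hw : w = u ++ (r.flatMap entryWord ++ v))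
    (hu : precedesRow (Transducer.scan w u.length) = true) :
    Exec z w (seekLeft precedesRow) ((u ++ r.flatMap entryWord).length + 1) c []
      (u.length + 1) c := by
  refine exec_seekLeft _ hw ?_ hu
  intro b hb
  simp only [List.mem_append, List.mem_flatMap, entryWord, coeffWord, List.mem_map,
    List.mem_singleton] at hb
  rcases hb with ⟨_, _, ⟨_, _, ⟨_, _, rfl⟩ | rfl⟩ | rfl⟩ <;> rfl

/-- The rows `0, …, n - 1` of the blocks have been emitted, and `t` rows are left. -/
theorem exec_putRowsLoop {T : ℕ} (r : List (List (List D)))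
    (hw : w = u ++ (r.flatMap entryWord ++ .inl .rowEnd :: v))
    (ht : n + t = T) (hT : T ≤ w.length)
    (hu : precedesRow (Transducer.scan w u.length) = true) :
    Exec z w (loop (nonzero 0) (dec 0 ⨾ inc 1 ⨾
      loop (sees fun sc => !isMark .rowEnd sc) putBlockRow ⨾ put .rowEnd ⨾ seekLeft precedesRow))
      (u.length + 1) ![t, n, 0, 0] ((List.range' n t).flatMap (rowOut z T r))
      (u.length + 1) ![0, T, 0, 0] := by
  induction t generalizing n with
  | zero =>
    subst ht
    simpa using Exec.loop_neg (by simp)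
  | succ t ih =>
    have h1 : Exec z w (dec 0) (u.length + 1) ![t + 1, n, 0, 0] [] (u.length + 1)
        ![t, n, 0, 0] :=
      exec_dec_to (n := t) (by simp) (by simp; omega) (by simp)
    have h2 : Exec z w (inc 1) (u.length + 1) ![t, n, 0, 0] [] (u.length + 1)
        ![t, n + 1, 0, 0] :=
      exec_inc_to (by simp; omega) (by simp)
    have h3 := exec_putBlockRows (z := z) (a := n) r hw (by omega) hT
      (precedesEntry_of_precedesRow hu)
    have hnt : T - 1 - n = t := by omega
    rw [hnt] at h3
    have h4 := exec_seekLeft_row (z := z) (c := ![t, n + 1, 0, 0]) r hw hu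
    have := Exec.loop_pos (test := nonzero 0) (by simp)
      (h1.seq_silent (h2.seq_silent (h3.seq ((exec_put .rowEnd).seq h4))))
      (ih (n := n + 1) (by omega))
    simpa [List.range'_succ, rowOut] using this

theorem exec_putRows {T : ℕ} (r : List (List (List D))) (hw : w = u ++ (rowWord r ++ v))
    (hT : T ≤ w.length) (hu : precedesRow (Transducer.scan w u.length) = true) :
    Exec z w putRows (u.length + 1) ![T, 0, 0, 0] ((List.range T).flatMap (rowOut z T r))
      ((u ++ rowWord r).length + 1) ![T, 0, 0, 0] := by
  have hw' : w = u ++ (r.flatMap entryWord ++ .inl .rowEnd :: v) := by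
    simpa [rowWord] using hw
  have h1 := exec_putRowsLoop (z := z) (n := 0) (t := T) r hw' (by omega) hT hu
  have h2 : Exec z w (transfer 1 0) (u.length + 1) ![0, T, 0, 0] [] (u.length + 1)
      ![T, 0, 0, 0] :=
    exec_transfer_to (by decide) (by simpa using hT) (by simp)
  have h3 : Exec z w (seekRight (isMark .rowEnd)) (u.length + 1) ![T, 0, 0, 0] []
      ((u ++ r.flatMap entryWord).length + 1) ![T, 0, 0, 0] := by
    refine exec_seekRight _ hw' ?_ ?_
    · intro b hb
      simp only [List.mem_append, List.mem_flatMap, entryWord, coeffWord, List.mem_map,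
        List.mem_singleton] at hb
      rcases hb with ⟨_, _, ⟨_, _, ⟨_, _, rfl⟩ | rfl⟩ | rfl⟩ <;> rfl
    · rw [scan_of_eq_append_cons (by rw [hw', List.append_assoc])]
      rfl
  have h4 := exec_right (z := z) (w := w) (c := ![T, 0, 0, 0]) (u := u ++ r.flatMap entryWord)
    (x := .inl .rowEnd) (v := v) (by rw [hw', List.append_assoc])
  have := h1.seq (h2.seq_silent (h3.seq h4))
  simpa only [putRows, rowWord, List.append_nil, List.append_assoc, List.range_eq_range'] using this

theorem exec_putMatrixLoop {T : ℕ} (m : List (List (List (List D))))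
    (hw : w = u ++ (m.flatMap rowWord ++ .inl .matrixEnd :: v))
    (hT : T ≤ w.length) (hu : precedesRow (Transducer.scan w u.length) = true) :
    Exec z w (loop (sees fun sc => !isMark .matrixEnd sc) putRows) (u.length + 1) ![T, 0, 0, 0]
      (m.flatMap fun r => (List.range T).flatMap (rowOut z T r))
      ((u ++ m.flatMap rowWord).length + 1) ![T, 0, 0, 0] := by
  induction m generalizing u with
  | nil =>
    have hs := scan_of_eq_append_cons (by simpa using hw)
    simpa using Exec.loop_neg (by simp [hs, isMark])
  | cons r m ih =>
    have h1 := exec_putRows (z := z) (v := m.flatMap rowWord ++ .inl .matrixEnd :: v) r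
      (by simp [hw]) hT hu
    have h2 := ih (u := u ++ rowWord r) (by simp [hw]) (by
      rw [rowWord, ← List.append_assoc, scan_of_eq_concat_append
        (v := m.flatMap rowWord ++ .inl .matrixEnd :: v) (by simp [hw, rowWord])]
      rfl)
    have hs : isMark .matrixEnd (Transducer.scan w (u.length + 1)) = false := by
      obtain ⟨x, v', hx, hx'⟩ := rowWord_eq_cons r
      rwa [scan_of_eq_append_cons (x := x) (v := v' ++ (m.flatMap rowWord ++ .inl .matrixEnd :: v))
        (by simp [hw, hx])]
    have := Exec.loop_pos (test := sees fun sc => !isMark .matrixEnd sc) (by simp [hs]) h1 h2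
    simpa using this

theorem exec_putMatrix {T : ℕ} (m : List (List (List (List D))))
    (hw : w = u ++ (matrixWord m ++ v))
    (hT : T ≤ w.length) (hu : precedesRow (Transducer.scan w u.length) = true) :
    Exec z w putMatrix (u.length + 1) ![T, 0, 0, 0] (matrixOut z T m)
      ((u ++ matrixWord m).length + 1) ![T, 0, 0, 0] := by
  have hw' : w = u ++ (m.flatMap rowWord ++ .inl .matrixEnd :: v) := by
    simpa [matrixWord] using hw
  have h1 := exec_putMatrixLoop (z := z) m hw' hT hu
  have h2 := exec_right (z := z) (w := w) (c := ![T, 0, 0, 0]) (u := u ++ m.flatMap rowWord)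
    (x := .inl .matrixEnd) (v := v) (by rw [hw', List.append_assoc])
  have := h1.seq ((exec_put .matrixEnd).seq h2)
  simpa only [putMatrix, matrixOut, matrixWord, List.append_nil, List.append_assoc] using this

theorem exec_putMatrices {T : ℕ} (A : List (List (List (List (List D)))))
    (hw : w = u ++ A.flatMap matrixWord)
    (hT : T ≤ w.length) (hu : precedesRow (Transducer.scan w u.length) = true) :
    Exec z w (loop (sees fun sc => match sc with | .rightEnd => false | _ => true) putMatrix)
      (u.length + 1) ![T, 0, 0, 0] (A.flatMap (matrixOut z T)) (w.length + 1) ![T, 0, 0, 0] := by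
  induction A generalizing u with
  | nil =>
    obtain rfl : w = u := by simpa using hw
    exact Exec.loop_neg (by simp [scan_length_add_one])
  | cons m A ih =>
    have h1 := exec_putMatrix (z := z) (v := A.flatMap matrixWord) m (by simp [hw]) hT hu
    have h2 := ih (u := u ++ matrixWord m) (by simp [hw]) (by
      rw [matrixWord, ← List.append_assoc, scan_of_eq_concat_append
        (v := A.flatMap matrixWord) (by simp [hw, matrixWord])]
      rfl)
    have hs : ∃ x v', w = u ++ x :: v' := by
      rcases h : matrixWord m with _ | ⟨x, v'⟩
      · simp [matrixWord] at h
      · exact ⟨x, v' ++ A.flatMap matrixWord, by simp [hw, h]⟩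
    obtain ⟨x, v', hs⟩ := hs
    refine Exec.loop_pos ?_ h1 h2
    rw [scan_of_eq_append_cons hs]
    cases x <;> rfl

/-- The symbol is the mark at the end of a coefficient. -/
def isCoeffEnd (a : Delim ⊕ D) : Bool := isMark .coeffEnd (look a)

theorem exec_countCoeffsLoop (x : List (Delim ⊕ D)) (hw : w = u ++ (x ++ v))
    (hx : ∀ a ∈ x, isRowEnd (look a) = false)
    (hv : isRowEnd (Transducer.scan w ((u ++ x).length + 1)) = true)
    (ht : t + x.countP isCoeffEnd ≤ w.length) :
    Exec z w (loop (sees fun sc => !isRowEnd sc)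
      (cond (sees (isMark .coeffEnd)) (inc 0) skip ⨾ right)) (u.length + 1) ![t, 0, 0, 0] []
      ((u ++ x).length + 1) ![t + x.countP isCoeffEnd, 0, 0, 0] := by
  induction x generalizing u t with
  | nil =>
    rw [List.append_nil] at hv ⊢
    exact Exec.loop_neg (by simp [hv])
  | cons a x ih =>
    have hs : Transducer.scan w (u.length + 1) = look a := scan_of_eq_append_cons hw
    have hi (t' : ℕ) (ht' : t' + x.countP isCoeffEnd ≤ w.length) :=
      ih (u := u ++ [a]) (t := t') (by simp [hw]) (fun b hb => hx b (by simp [hb]))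
        (by simpa using hv) ht'
    have hr (c : Fin 4 → ℕ) := exec_right (z := z) (w := w) (c := c) (x := a) (v := x ++ v) hw
    rw [List.countP_cons] at ht ⊢
    cases ha : isCoeffEnd a
    · have := Exec.loop_pos (test := sees fun sc => !isRowEnd sc) (by simp [hs, hx a (by simp)])
        ((Exec.cond_neg (test := sees (isMark .coeffEnd)) (M := inc 0)
          (by rw [hs]; exact ha) exec_skip).seq (hr _)) (hi t (by simp [ha] at ht; exact ht))
      simpa [ha] using this
    · rw [ha] at ht
      have := Exec.loop_pos (test := sees fun sc => !isRowEnd sc) (by simp [hs, hx a (by simp)])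
        ((Exec.cond_pos (test := sees (isMark .coeffEnd)) (N := skip)
          (by rw [hs]; exact ha) (exec_inc_to (c := ![t, 0, 0, 0]) (c' := ![t + 1, 0, 0, 0])
            (by simp at ht ⊢; omega) (by simp))).seq (hr _))
        (hi (t + 1) (by simp at ht; omega))
      simpa [ha, add_assoc, add_comm 1] using this

/-- Here `x` is the part of the input before the end of the first row. -/
theorem exec_putToeplitz (A : List (List (List (List (List D))))) (x : List (Delim ⊕ D))
    (hw : A.flatMap matrixWord = x ++ v) (hx : ∀ a ∈ x, isRowEnd (look a) = false)
    (hv : v = [] ∨ ∃ v', v = .inl .rowEnd :: v') :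
    ∃ p c, Exec z (A.flatMap matrixWord) putToeplitz 0 (fun _ => 0)
      (A.flatMap (matrixOut z (x.countP isCoeffEnd))) p c := by
  generalize hW : A.flatMap matrixWord = w at hw
  have hT : x.countP isCoeffEnd ≤ w.length := by
    rw [hw, List.length_append]
    exact List.countP_le_length.trans (Nat.le_add_right _ _)
  have h0 : (fun _ => 0 : Fin 4 → ℕ) = ![0, 0, 0, 0] := by
    funext i; fin_cases i <;> rfl
  have h1 : Exec z w (act .right .nothing) 0 ![0, 0, 0, 0] [] 1 ![0, 0, 0, 0] := by
    have h := exec_act (z := z) (w := w) (p := 0) (c := ![0, 0, 0, 0]) .right .nothing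
    have hm : min (0 + 1) (w.length + 1) = 1 := by simp
    simpa only [Transducer.emitted, Transducer.moveInput, hm] using h
  have h2 := exec_countCoeffsLoop (z := z) (u := []) (t := 0) x hw hx (by
    rcases hv with rfl | ⟨v', rfl⟩
    · rw [List.nil_append, show x = w by simp [hw], scan_length_add_one]
      rfl
    · rw [List.nil_append, scan_of_eq_append_cons hw]
      rfl) (by simpa using hT)
  rw [zero_add] at h2
  have h3 : Exec z w (seekLeft isLeftEnd) (([] ++ x).length + 1)
      ![x.countP isCoeffEnd, 0, 0, 0] [] 1 ![x.countP isCoeffEnd, 0, 0, 0] := by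
    refine exec_seekLeft (u := []) _ hw ?_ rfl
    intro a ha
    cases a <;> rfl
  have h4 := exec_putMatrices (z := z) (u := []) A hW.symm hT rfl
  rw [h0]
  exact ⟨_, _, (h1.seq_silent (h2.seq_silent h3)).seq_silent h4⟩

end Routine

/-! ### The transducer that locates the coefficients -/

namespace Routine

/-- The scanned cell holds the unary digit. -/
def isTick : Scan Bool → Bool
  | .delim true => true
  | _ => false

/-- Perform `M` for every digit of the number at the input head, and go behind that number. -/
def forTicks {k : ℕ} (M : Routine Bool k) : Routine Bool k :=
  loop (sees isTick) (M ⨾ right) ⨾ right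

/-- With `n` in counter 0 and `d` in counter 1, emit `n * (d + 1)` in unary digits. -/
def putSize : Routine Bool 5 :=
  loop (nonzero 0) (dec 0 ⨾ inc 3 ⨾ put true ⨾
    loop (nonzero 1) (dec 1 ⨾ inc 4 ⨾ put true) ⨾ transfer 4 1) ⨾ transfer 3 0

/-- On input `n, d, i, j, k` emit `i * (n * (d + 1)) + k` and `j * (n * (d + 1))`; only `n`, `d` and
`j` are stored, in the counters 0, 1 and 2, while `i` and `k` are counted off on the input. -/
def putIndices : Routine Bool 5 :=
  right ⨾ forTicks (inc 0) ⨾ forTicks (inc 1) ⨾ forTicks putSize ⨾ forTicks (inc 2) ⨾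
    forTicks (put true) ⨾ put false ⨾ loop (nonzero 2) (dec 2 ⨾ putSize) ⨾ put false

variable {D : Type*} {z : List D} {w u v : List (Bool ⊕ D)}

/-- The word for a number. -/
def natWord (D : Type*) (a : ℕ) : List (Bool ⊕ D) := List.replicate a (.inl true) ++ [.inl false]

/-- `C m` are the counters after `m` repetitions. -/
theorem exec_forTicks {k : ℕ} {M : Routine Bool k} (a : ℕ) (C : ℕ → Fin k → ℕ)
    (o : List (Bool ⊕ D)) (hw : w = u ++ (natWord D a ++ v))
    (h : ∀ p m, m < a → Exec z w M p (C m) o p (C (m + 1))) :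
    Exec z w (forTicks M) (u.length + 1) (C 0) (List.replicate a o).flatten
      ((u ++ natWord D a).length + 1) (C a) := by
  replace hw : w = u ++ (List.replicate a (.inl true) ++ .inl false :: v) := by
    simpa [natWord] using hw
  have hloop : Exec z w (loop (sees isTick) (M ⨾ right)) (u.length + 1) (C 0)
      (List.replicate a o).flatten
      ((u ++ List.replicate a (Sum.inl true)).length + 1) (C a) := by
    induction a generalizing u C with
    | zero =>
      have hs := scan_of_eq_append_cons (by simpa using hw)
      simpa using Exec.loop_neg (by simp [hs, isTick])
    | succ a ih =>
      rw [List.replicate_succ, List.cons_append] at hw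
      have hs := scan_of_eq_append_cons hw
      have := Exec.loop_pos (test := sees isTick) (by simp [hs, isTick])
        ((h _ 0 (by omega)).seq (exec_right hw))
        (ih (fun m => C (m + 1)) (u := u ++ [.inl true])
          (fun p m hm => h p (m + 1) (by omega)) (by simp [hw]))
      simpa [List.replicate_succ] using this
  have hr := exec_right (z := z) (w := w) (c := C a)
    (u := u ++ List.replicate a (Sum.inl true)) (x := .inl false) (v := v) (by simp [hw])
  simpa only [forTicks, natWord, List.append_nil, List.append_assoc] using hloop.seq hr

theorem update_vec5_zero (a b c d e x : ℕ) :
    Function.update ![a, b, c, d, e] 0 x = ![x, b, c, d, e] := by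
  funext i; fin_cases i <;> rfl

theorem update_vec5_one (a b c d e x : ℕ) :
    Function.update ![a, b, c, d, e] 1 x = ![a, x, c, d, e] := by
  funext i; fin_cases i <;> rfl

theorem update_vec5_two (a b c d e x : ℕ) :
    Function.update ![a, b, c, d, e] 2 x = ![a, b, x, d, e] := by
  funext i; fin_cases i <;> rfl

theorem update_vec5_three (a b c d e x : ℕ) :
    Function.update ![a, b, c, d, e] 3 x = ![a, b, c, x, e] := by
  funext i; fin_cases i <;> rfl

theorem update_vec5_four (a b c d e x : ℕ) :
    Function.update ![a, b, c, d, e] 4 x = ![a, b, c, d, x] := by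
  funext i; fin_cases i <;> rfl

attribute [local simp] update_vec5_zero update_vec5_one update_vec5_two update_vec5_three
  update_vec5_four

variable {n d j n' d' p : ℕ}

theorem exec_putSize_inner (h : d + d' ≤ w.length) :
    Exec z w (loop (nonzero 1) (dec 1 ⨾ inc 4 ⨾ put true)) p ![n, d, j, n', d']
      (List.replicate d (.inl true)) p ![n, 0, j, n', d' + d] := by
  induction d generalizing d' with
  | zero => simpa using Exec.loop_neg (by simp)
  | succ d ih =>
    have h1 : Exec z w (dec 1) p ![n, d + 1, j, n', d'] [] p ![n, d, j, n', d'] :=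
      exec_dec_to (n := d) (by simp) (by simp; omega) (by simp)
    have h2 : Exec z w (inc 4) p ![n, d, j, n', d'] [] p ![n, d, j, n', d' + 1] :=
      exec_inc_to (by simp; omega) (by simp)
    have := Exec.loop_pos (test := nonzero 1) (by simp)
      (h1.seq_silent (h2.seq_silent (exec_put true))) (ih (d' := d' + 1) (by omega))
    simpa [List.replicate_succ, add_assoc, add_comm 1] using this

theorem exec_putSize (hn : n ≤ w.length) (hd : d ≤ w.length) :
    Exec z w putSize p ![n, d, j, 0, 0] (List.replicate (n * (d + 1)) (.inl true)) p
      ![n, d, j, 0, 0] := by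
  have hloop (n' : ℕ) (h : n + n' ≤ w.length) :
      Exec z w (loop (nonzero 0) (dec 0 ⨾ inc 3 ⨾ put true ⨾
        loop (nonzero 1) (dec 1 ⨾ inc 4 ⨾ put true) ⨾ transfer 4 1)) p ![n, d, j, n', 0]
        (List.replicate (n * (d + 1)) (.inl true)) p ![0, d, j, n' + n, 0] := by
    clear hn
    induction n generalizing n' with
    | zero => simpa using Exec.loop_neg (by simp)
    | succ n ih =>
      have h1 : Exec z w (dec 0) p ![n + 1, d, j, n', 0] [] p ![n, d, j, n', 0] :=
        exec_dec_to (n := n) (by simp) (by simp; omega) (by simp)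
      have h2 : Exec z w (inc 3) p ![n, d, j, n', 0] [] p ![n, d, j, n' + 1, 0] :=
        exec_inc_to (by simp; omega) (by simp)
      have h3 := exec_putSize_inner (z := z) (w := w) (n := n) (d := d) (j := j) (n' := n' + 1)
        (d' := 0) (p := p) (by omega)
      have h4 : Exec z w (transfer 4 1) p ![n, 0, j, n' + 1, 0 + d] [] p ![n, d, j, n' + 1, 0] :=
        exec_transfer_to (by decide) (by simpa using hd) (by simp)
      have := Exec.loop_pos (test := nonzero 0) (by simp)
        (h1.seq_silent (h2.seq_silent ((exec_put true).seq (h3.seq h4))))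
        (ih (n' + 1) (by omega))
      have hr : List.replicate ((n + 1) * (d + 1)) (Sum.inl true : Bool ⊕ D) =
          .inl true :: (List.replicate d (.inl true) ++
            List.replicate (n * (d + 1)) (.inl true)) := by
        rw [List.replicate_append_replicate, ← List.replicate_succ]
        congr 1
        ring
      simpa [hr, add_assoc, add_comm 1] using this
  have h2 : Exec z w (transfer 3 0) p ![0, d, j, 0 + n, 0] [] p ![n, d, j, 0, 0] :=
    exec_transfer_to (by decide) (by simpa using hn) (by simp)
  simpa only [putSize, List.append_nil] using (hloop 0 (by omega)).seq h2

theorem exec_putSizes (hn : n ≤ w.length) (hd : d ≤ w.length) (hj : j ≤ w.length) :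
    Exec z w (loop (nonzero 2) (dec 2 ⨾ putSize)) p ![n, d, j, 0, 0]
      (List.replicate (j * (n * (d + 1))) (.inl true)) p ![n, d, 0, 0, 0] := by
  induction j with
  | zero => simpa using Exec.loop_neg (by simp)
  | succ j ih =>
    have h1 : Exec z w (dec 2) p ![n, d, j + 1, 0, 0] [] p ![n, d, j, 0, 0] :=
      exec_dec_to (n := j) (by simp) (by simpa using hj) (by simp)
    have := Exec.loop_pos (test := nonzero 2) (by simp)
      (h1.seq_silent (exec_putSize hn hd)) (ih (by omega))
    rwa [List.replicate_append_replicate, add_comm (n * (d + 1)), ← Nat.succ_mul] at this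

theorem exec_putIndices (z : List Empty) (n d i j k : ℕ) :
    ∃ p c, Exec z (encodeNats [n, d, i, j, k]) putIndices 0 (fun _ => 0)
      (encodeNats [i * (n * (d + 1)) + k, j * (n * (d + 1))]) p c := by
  have hin : encodeNats [n, d, i, j, k] = natWord Empty n ++ (natWord Empty d ++
      (natWord Empty i ++ (natWord Empty j ++ (natWord Empty k ++ [])))) := by
    simp [encodeNats, natWord]
  generalize encodeNats [n, d, i, j, k] = w at hin
  have hlen : n ≤ w.length ∧ d ≤ w.length ∧ j ≤ w.length := by
    simp [hin, natWord]
    omega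
  obtain ⟨hn, hd, hj⟩ := hlen
  have h0 : (fun _ => 0 : Fin 5 → ℕ) = ![0, 0, 0, 0, 0] := by
    funext i; fin_cases i <;> rfl
  have h1 : Exec z w right 0 ![0, 0, 0, 0, 0] [] 1 ![0, 0, 0, 0, 0] := by
    have h := exec_act (z := z) (w := w) (p := 0) (c := ![0, 0, 0, 0, 0]) .right .nothing
    have hm : min (0 + 1) (w.length + 1) = 1 := by simp
    simpa only [Transducer.emitted, Transducer.moveInput, hm] using h
  have h2 := exec_forTicks (z := z) (u := []) (M := inc 0) n (fun m => ![m, 0, 0, 0, 0]) [] hin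
    fun p m hm => exec_inc_to (by simp; omega) (by simp)
  have h3 := exec_forTicks (z := z) (w := w) (u := [] ++ natWord Empty n) (M := inc 1) d
    (fun m => ![n, m, 0, 0, 0]) [] (by rw [hin]; simp only [List.nil_append]; rfl)
    fun p m hm => exec_inc_to (by simp; omega) (by simp)
  have h4 := exec_forTicks (z := z) (w := w) (u := [] ++ natWord Empty n ++ natWord Empty d)
    (M := putSize) i (fun m => ![n, d, 0, 0, 0]) _
    (by rw [hin]; simp only [List.nil_append, List.append_assoc]; rfl)
    fun p m hm => exec_putSize hn hd
  have h5 := exec_forTicks (z := z) (w := w)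
    (u := [] ++ natWord Empty n ++ natWord Empty d ++ natWord Empty i)
    (M := inc 2) j (fun m => ![n, d, m, 0, 0]) []
    (by rw [hin]; simp only [List.nil_append, List.append_assoc]; rfl)
    fun p m hm => exec_inc_to (by simp; omega) (by simp)
  have h6 := exec_forTicks (z := z) (w := w)
    (u := [] ++ natWord Empty n ++ natWord Empty d ++ natWord Empty i ++ natWord Empty j)
    (M := put true) k (fun m => ![n, d, j, 0, 0]) _
    (by rw [hin]; simp only [List.nil_append, List.append_assoc]; rfl)
    fun p m hm => exec_put true
  have h := h1.seq (h2.seq (h3.seq (h4.seq (h5.seq (h6.seq ((exec_put false).seq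
    ((exec_putSizes hn hd hj).seq (exec_put false))))))))
  rw [h0]
  have ho (o) (h : o = encodeNats [i * (n * (d + 1)) + k, j * (n * (d + 1))]) {p c}
      (he : Exec z w putIndices 0 ![0, 0, 0, 0, 0] o p c) := h ▸ he
  exact ⟨_, _, ho _ (by simp [encodeNats, ← List.replicate_append_replicate]) h⟩

end Routine

/-! ### Toeplitz matrices -/

section Toeplitz

variable {R : Type*} [CommRing R]

theorem toeplitz_apply (T : ℕ) (f : Polynomial R) (a b : Fin T) :
    toeplitz T f a b = if b ≤ a then f.coeff ((a : ℕ) - (b : ℕ)) else 0 := rfl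

theorem toeplitz_one (T : ℕ) : toeplitz T (1 : Polynomial R) = 1 := by
  ext a b
  rw [toeplitz_apply, Matrix.one_apply, Polynomial.coeff_one]
  rcases lt_trichotomy a b with h | rfl | h
  · rw [if_neg (not_le.2 h), if_neg h.ne]
  · simp
  · rw [if_pos h.le, if_neg h.ne', if_neg]
    have : (b : ℕ) < a := h
    omega

theorem toeplitz_sum {ι : Type*} (s : Finset ι) (T : ℕ) (f : ι → Polynomial R) :
    toeplitz T (∑ i ∈ s, f i) = ∑ i ∈ s, toeplitz T (f i) := by
  ext a b
  rw [Matrix.sum_apply]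
  simp only [toeplitz_apply, Polynomial.finsetSum_coeff]
  split_ifs <;> simp

/-- In the product of two lower-triangular Toeplitz matrices, the entry at `(a, c)` is the
convolution of the coefficients over the indices between `c` and `a`. -/
theorem toeplitz_mul (T : ℕ) (f g : Polynomial R) :
    toeplitz T (f * g) = toeplitz T f * toeplitz T g := by
  ext a c
  rw [Matrix.mul_apply]
  have h1 : ∑ b, toeplitz T f a b * toeplitz T g b c = ∑ b ∈ Finset.range T,
      if (c : ℕ) ≤ b ∧ b ≤ a then f.coeff (a - b) * g.coeff (b - c) else 0 := by
    rw [← Fin.sum_univ_eq_sum_range fun b =>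
      if (c : ℕ) ≤ b ∧ b ≤ a then f.coeff (a - b) * g.coeff (b - c) else 0]
    refine Finset.sum_congr rfl fun b _ => ?_
    simp only [toeplitz_apply, Fin.le_def]
    by_cases hb : (b : ℕ) ≤ a <;> by_cases hc : (c : ℕ) ≤ b <;> simp [hb, hc]
  have h2 : (Finset.range T).filter (fun b => (c : ℕ) ≤ b ∧ b ≤ a) =
      Finset.Ico (c : ℕ) (a + 1) := by
    ext b
    simp only [Finset.mem_filter, Finset.mem_range, Finset.mem_Ico]
    omega
  rw [h1, ← Finset.sum_filter, h2, toeplitz_apply]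
  split_ifs with h
  · have h : (c : ℕ) ≤ a := h
    rw [Finset.sum_Ico_eq_sum_range, mul_comm f g, Polynomial.coeff_mul,
      Finset.Nat.sum_antidiagonal_eq_sum_range_succ fun i j => g.coeff i * f.coeff j,
      Nat.succ_eq_add_one, show (a : ℕ) + 1 - c = a - c + 1 by omega]
    refine Finset.sum_congr rfl fun i _ => ?_
    rw [mul_comm, Nat.add_sub_cancel_left, Nat.sub_sub]
  · have h : ¬(c : ℕ) ≤ a := h
    rw [Finset.Ico_eq_empty (by omega), Finset.sum_empty]

variable {n : ℕ}

theorem blockToeplitz_one (T : ℕ) :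
    blockToeplitz T (1 : Matrix (Fin n) (Fin n) (Polynomial R)) = 1 := by
  ext r s
  obtain ⟨⟨i, a⟩, rfl⟩ := finProdFinEquiv.surjective r
  obtain ⟨⟨j, b⟩, rfl⟩ := finProdFinEquiv.surjective s
  simp only [blockToeplitz, Matrix.of_apply, Equiv.symm_apply_apply, Matrix.one_apply,
    EmbeddingLike.apply_eq_iff_eq, Prod.mk.injEq]
  by_cases h : i = j
  · simp [h, toeplitz_one, Matrix.one_apply]
  · simp [h, toeplitz_apply]

theorem blockToeplitz_mul (T : ℕ) (A B : Matrix (Fin n) (Fin n) (Polynomial R)) :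
    blockToeplitz T (A * B) = blockToeplitz T A * blockToeplitz T B := by
  ext r s
  rw [Matrix.mul_apply, ← finProdFinEquiv.sum_comp, Fintype.sum_prod_type]
  simp only [blockToeplitz, Matrix.of_apply, Equiv.symm_apply_apply, Matrix.mul_apply,
    toeplitz_sum, toeplitz_mul, Matrix.sum_apply]

theorem blockToeplitz_list_prod (T : ℕ) (L : List (Matrix (Fin n) (Fin n) (Polynomial R))) :
    (L.map (blockToeplitz T)).prod = blockToeplitz T L.prod := by
  induction L with
  | nil => exact (blockToeplitz_one T).symm
  | cons A L ih => rw [List.map_cons, List.prod_cons, List.prod_cons, ih, blockToeplitz_mul]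

/-- The first column of a Toeplitz block lists the coefficients. -/
theorem blockToeplitz_first_column {T k : ℕ} (A : Matrix (Fin n) (Fin n) (Polynomial R))
    (i j : Fin n) (hk : k < T) (hr : i * T + k < n * T) (hs : j * T < n * T) :
    blockToeplitz T A ⟨i * T + k, hr⟩ ⟨j * T, hs⟩ = (A i j).coeff k := by
  have h1 : (⟨i * T + k, hr⟩ : Fin (n * T)) = finProdFinEquiv (i, ⟨k, hk⟩) := by
    ext
    simp [finProdFinEquiv]
    ring
  have h2 : (⟨j * T, hs⟩ : Fin (n * T)) = finProdFinEquiv (j, ⟨0, by omega⟩) := by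
    ext
    simp [finProdFinEquiv]
    ring
  rw [h1, h2]
  simp only [blockToeplitz, Matrix.of_apply, Equiv.symm_apply_apply, toeplitz_apply]
  exact if_pos (Nat.zero_le _)

end Toeplitz

/-! ### Encodings as nested lists -/

section Encoding

variable {R D : Type*} [CommRing R] {n d : ℕ} (enc : R → List D)

/-- The codes of the coefficients of `x^0, …, x^d`. -/
def coeffCodes (d : ℕ) (f : Polynomial R) : List (List D) :=
  (List.range (d + 1)).map fun k => enc (f.coeff k)

/-- The nested list of the codes of all coefficients of a tuple of matrices. -/
def nestedCodes (d : ℕ) (A : Fin n → Matrix (Fin n) (Fin n) (Polynomial R)) :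
    List (List (List (List (List D)))) :=
  (List.finRange n).map fun l => (List.finRange n).map fun i => (List.finRange n).map fun j =>
    coeffCodes enc d (A l i j)

theorem flatMap_matrixWord_nestedCodes (A : Fin n → Matrix (Fin n) (Fin n) (Polynomial R)) :
    (nestedCodes enc d A).flatMap Routine.matrixWord = encodeMatrices (encodePoly enc d) A := by
  simp [nestedCodes, encodeMatrices, encodePoly, encodeElem, coeffCodes, List.flatMap_map,
    Routine.matrixWord, Routine.rowWord, Routine.entryWord, Routine.coeffWord]

theorem getD_coeffCodes {f : Polynomial R} (hf : f.natDegree ≤ d) (i : ℕ) :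
    (coeffCodes enc d f).getD i (enc 0) = enc (f.coeff i) := by
  rw [coeffCodes, List.getD_eq_getElem?_getD, List.getElem?_map]
  rcases lt_or_ge i (d + 1) with h | h
  · simp [List.getElem?_range h]
  · rw [List.getElem?_eq_none (by simpa using h),
      Polynomial.coeff_eq_zero_of_natDegree_lt (by omega)]
    rfl

theorem flatMap_finRange {α : Type*} (T : ℕ) (g : ℕ → List α) :
    (List.finRange T).flatMap (fun b : Fin T => g b) = (List.range T).flatMap g := by
  rw [← List.map_coe_finRange_eq_range, List.flatMap_map]

/-- The emitted word is row `a` of the Toeplitz matrix of `f`: the column index `b` runs upwards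
while the index `a - b` of the coefficient runs downwards. -/
theorem blockRowOut_coeffCodes {T a : ℕ} {f : Polynomial R} (hf : f.natDegree ≤ d) (ha : a < T) :
    Routine.blockRowOut (enc 0) T a (coeffCodes enc d f) = (List.range T).flatMap fun b =>
      encodeElem enc (if b ≤ a then f.coeff (a - b) else 0) ++ [.inl .entryEnd] := by
  obtain ⟨m, rfl⟩ : ∃ m, T = (a + 1) + m := ⟨T - (a + 1), by omega⟩
  rw [List.range_add, List.flatMap_append, Routine.blockRowOut,
    show (a + 1) + m - 1 - a = m by omega]
  congr 1
  · rw [List.range_eq_range', List.reverse_range', ← List.range_eq_range', List.flatMap_map]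
    refine List.flatMap_congr fun b hb => ?_
    rw [List.mem_range] at hb
    rw [if_pos (by omega), Routine.coeffOut, getD_coeffCodes enc hf, encodeElem]
    simp
  · rw [List.flatMap_map]
    refine List.flatMap_congr fun b hb => ?_
    rw [if_neg (by omega), encodeElem]

/-- The rows of a block matrix, ordered by block rows. -/
theorem finRange_mul (n T : ℕ) : List.finRange (n * T) =
    (List.finRange n).flatMap fun i => (List.finRange T).map fun a => finProdFinEquiv (i, a) := by
  apply List.map_injective_iff.2 Fin.val_injective
  rw [List.map_coe_finRange_eq_range, List.map_flatMap]
  have h (i : Fin n) : ((List.finRange T).map fun a => finProdFinEquiv (i, a)).map Fin.val =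
      (List.range T).map (fun a => a + T * i) := by
    rw [← List.map_coe_finRange_eq_range, List.map_map, List.map_map]
    rfl
  simp only [h]
  rw [flatMap_finRange n fun i => (List.range T).map (fun a => a + T * i)]
  induction n with
  | zero => simp
  | succ n ih =>
    rw [List.range_succ, List.flatMap_append, ← ih fun i => by
      rw [← List.map_coe_finRange_eq_range, List.map_map, List.map_map]; rfl]
    rw [Nat.succ_mul, List.range_add]
    simp [mul_comm, add_comm]

theorem flatMap_matrixOut_nestedCodes {A : Fin n → Matrix (Fin n) (Fin n) (Polynomial R)} (T : ℕ)
    (hA : ∀ l i j, (A l i j).natDegree ≤ d) :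
    (nestedCodes enc d A).flatMap (Routine.matrixOut (enc 0) T) =
      encodeMatrices (encodeElem enc) fun l => blockToeplitz T (A l) := by
  rw [nestedCodes, List.flatMap_map, encodeMatrices]
  refine List.flatMap_congr fun l _ => ?_
  rw [Routine.matrixOut, List.flatMap_map, finRange_mul, List.flatMap_assoc]
  congr 1
  refine List.flatMap_congr fun i _ => ?_
  rw [List.flatMap_map, ← flatMap_finRange T]
  refine List.flatMap_congr fun a _ => ?_
  rw [Routine.rowOut, List.flatMap_map, List.flatMap_assoc]
  congr 1
  refine List.flatMap_congr fun j _ => ?_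
  rw [blockRowOut_coeffCodes enc (hA l i j) a.isLt, List.flatMap_map, ← flatMap_finRange T]
  simp only [blockToeplitz, Matrix.of_apply, Equiv.symm_apply_apply, toeplitz_apply, Fin.le_def]

theorem countP_flatMap_entryWord (r : List (List (List D))) :
    (r.flatMap Routine.entryWord).countP Routine.isCoeffEnd = (r.map List.length).sum := by
  have hc (a : List D) : (Routine.coeffWord a).countP Routine.isCoeffEnd = 1 := by
    rw [Routine.coeffWord, List.countP_append, List.countP_eq_zero.2]
    · rfl
    · simp [Routine.isCoeffEnd, Routine.isMark]
  have he (e : List (List D)) : (Routine.entryWord e).countP Routine.isCoeffEnd = e.length := by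
    induction e with
    | nil => rfl
    | cons a e ih =>
      rw [Routine.entryWord, List.flatMap_cons, List.append_assoc, List.countP_append, hc,
        ← Routine.entryWord, ih, List.length_cons, add_comm]
  induction r with
  | nil => rfl
  | cons e r ih => rw [List.flatMap_cons, List.countP_append, he, ih, List.map_cons, List.sum_cons]

theorem computesInLogspace_putToeplitz {A : Fin n → Matrix (Fin n) (Fin n) (Polynomial R)}
    (hA : ∀ l i j, (A l i j).natDegree ≤ d) :
    Routine.putToeplitz.toTransducer.ComputesInLogspace 1 (enc 0)
      (encodeMatrices (encodePoly enc d) A)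
      (encodeMatrices (encodeElem enc) fun l => blockToeplitz (n * (d + 1)) (A l)) := by
  obtain ⟨x, v, hw, hx, hv, hT⟩ : ∃ x v,
      (nestedCodes enc d A).flatMap Routine.matrixWord = x ++ v ∧
      (∀ a ∈ x, Routine.isRowEnd (Routine.look a) = false) ∧
      (v = [] ∨ ∃ v', v = .inl .rowEnd :: v') ∧ x.countP Routine.isCoeffEnd = n * (d + 1) := by
    rcases n with _ | n
    · exact ⟨[], [], by simp [nestedCodes], by simp, .inl rfl, by simp⟩
    · obtain ⟨m, L, hmL⟩ : ∃ m L, nestedCodes enc d A =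
          (((List.finRange (n + 1)).map fun j => coeffCodes enc d (A 0 0 j)) :: m) :: L := by
        simp only [nestedCodes]
        rw [List.finRange_succ, List.map_cons, List.map_cons]
        exact ⟨_, _, rfl⟩
      refine ⟨((List.finRange (n + 1)).map fun j => coeffCodes enc d (A 0 0 j)).flatMap
        Routine.entryWord, .inl .rowEnd :: (m.flatMap Routine.rowWord ++ .inl .matrixEnd ::
          L.flatMap Routine.matrixWord), ?_, ?_, .inr ⟨_, rfl⟩, ?_⟩
      · simp [hmL, Routine.matrixWord, Routine.rowWord]
      · intro b hb
        simp only [List.mem_append, List.mem_flatMap, Routine.entryWord, Routine.coeffWord,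
          List.mem_map, List.mem_singleton] at hb
        rcases hb with ⟨_, _, ⟨_, _, ⟨_, _, rfl⟩ | rfl⟩ | rfl⟩ <;> rfl
      · rw [countP_flatMap_entryWord, List.map_map]
        simp [Function.comp_def, coeffCodes]
  obtain ⟨p, c, h⟩ := Routine.exec_putToeplitz (z := enc 0) _ x hw hx hv
  rw [hT, flatMap_matrixWord_nestedCodes, flatMap_matrixOut_nestedCodes enc _ hA] at h
  exact h.computesInLogspace

end Encoding

end LogspaceIMM

theorem mainTheorem7 :
    ∃ (F : LogspaceIMM.Transducer LogspaceIMM.Delim) (G : LogspaceIMM.Transducer Bool) (c : ℕ)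
      (T : ℕ → ℕ → ℕ) (ψ : ℕ → ℕ → ℕ → ℕ → ℕ → ℕ × ℕ),
      -- the matrices over `R` have polynomial size
      (∀ p : Polynomial ℕ, ∃ q : Polynomial ℕ, ∀ n d : ℕ, d ≤ p.eval n → n * T n d ≤ q.eval n) ∧
      -- `ψ` is logspace computable
      (∀ n d i j k : ℕ, i < n → j < n → k ≤ n * d →
        G.ComputesInLogspace c [] (LogspaceIMM.encodeNats [n, d, i, j, k])
          (LogspaceIMM.encodeNats [(ψ n d i j k).1, (ψ n d i j k).2])) ∧
      ∀ (R : Type*) [CommRing R],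
        (∀ (N : ℕ) (f g : Polynomial R), LogspaceIMM.toeplitz N (f * g) =
          LogspaceIMM.toeplitz N f * LogspaceIMM.toeplitz N g) ∧
        ∀ (n d : ℕ) (A : Fin n → Matrix (Fin n) (Fin n) (Polynomial R)),
          (∀ l i j, (A l i j).natDegree ≤ d) →
          ∃ B : Fin n → Matrix (Fin (n * T n d)) (Fin (n * T n d)) R,
            (∀ l, B l = LogspaceIMM.blockToeplitz (T n d) (A l)) ∧
            -- `B` is computed from `A` in logspace, whatever the encoding of ring elements
            (∀ (D : Type*) (enc : R → List D),
              F.ComputesInLogspace c (enc 0)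
                (LogspaceIMM.encodeMatrices (LogspaceIMM.encodePoly enc d) A)
                (LogspaceIMM.encodeMatrices (LogspaceIMM.encodeElem enc) B)) ∧
            -- the coefficients of the product over `R[x]` are entries of the product over `R`
            ∀ (i j : Fin n) (k : ℕ), k ≤ n * d →
              ∃ (hr : (ψ n d i j k).1 < n * T n d) (hs : (ψ n d i j k).2 < n * T n d),
                ((List.ofFn A).prod i j).coeff k =
                  (List.ofFn B).prod ⟨(ψ n d i j k).1, hr⟩ ⟨(ψ n d i j k).2, hs⟩ := by

  refine ⟨LogspaceIMM.Routine.putToeplitz.toTransducer,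
    LogspaceIMM.Routine.putIndices.toTransducer, 1, fun n d => n * (d + 1),
    fun n d i j k => (i * (n * (d + 1)) + k, j * (n * (d + 1))), ?_, ?_, ?_⟩
  · intro p
    refine ⟨Polynomial.X * (Polynomial.X * (p + 1)), fun n d hd => ?_⟩
    simp only [Polynomial.eval_mul, Polynomial.eval_X, Polynomial.eval_add, Polynomial.eval_one]
    gcongr
  · intro n d i j k _ _ _
    obtain ⟨p, c, h⟩ := LogspaceIMM.Routine.exec_putIndices [] n d i j k
    exact h.computesInLogspace
  · intro R _
    refine ⟨LogspaceIMM.toeplitz_mul, fun n d A hA => ⟨fun l => LogspaceIMM.blockToeplitz _ (A l),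
      fun _ => rfl, fun D enc => LogspaceIMM.computesInLogspace_putToeplitz enc hA,
      fun i j k hk => ?_⟩⟩
    have hkT : k < n * (d + 1) := by
      have := i.pos
      rw [Nat.mul_succ]
      omega
    have hi : (i : ℕ) * (n * (d + 1)) + n * (d + 1) ≤ n * (n * (d + 1)) := by
      rw [← Nat.succ_mul]
      exact Nat.mul_le_mul_right _ i.isLt
    have hj : (j : ℕ) * (n * (d + 1)) + n * (d + 1) ≤ n * (n * (d + 1)) := by
      rw [← Nat.succ_mul]
      exact Nat.mul_le_mul_right _ j.isLt
    refine ⟨by dsimp only; omega, by dsimp only; omega, ?_⟩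
    have hB : (List.ofFn fun l => LogspaceIMM.blockToeplitz (n * (d + 1)) (A l)) =
        (List.ofFn A).map (LogspaceIMM.blockToeplitz (n * (d + 1))) := by
      rw [List.map_ofFn]
      rfl
    rw [hB, LogspaceIMM.blockToeplitz_list_prod]
    exact (LogspaceIMM.blockToeplitz_first_column _ i j hkT _ _).symm
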